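/- **Setting.** Let $0\le a_1<a_2$ and $0\le b_1<b_2$. The leader's type has a probability density $f_1\ge 0$ with support $[a_1,a_2]$ (so $f_1=0$ off $[a_1,a_2]$ and every nondegenerate subinterval of $[a_1,a_2]$ has positive mass) and distribution function $F_1$. The follower's type has a probability density $f_2\ge 0$ that vanishes off $[b_1,b_2]$ and is continuous on $[b_1,b_2]$, with distribution function $F_2$. The payment functions $p^w,p^p:\mathbb R\to\mathbb R$ (additional payment of a winner, and payment for participation) are continuously differentiable with $p^w(0)=p^p(0)=0$; on $[0,\infty)$ we have $(p^w)'\ge 0$, $(p^p)'\ge 0$ and $(p^w)'+(p^p)'>0$; and $p^w(t)+p^p(t)\ge b_2$ for some $t\ge 0$. An *equal-bid function* is a weakly increasing, left-continuous function $g:(a_1,a_2]\to[0,b_2]$. The leader's strategy $s=s_g:(a_1,a_2]\to[0,\infty)$ that belongs to $g$ is given by $$\int_{a_1}^{x}f_1(t)g(t)\,dt=p^w(s(x))F_1(x)+p^p(s(x)),\qquad x\in(a_1,a_2].$$ The leader's utility is $$U(g)=\int_{a_1}^{a_2}\bigl\{[x-p^w(s(x))]\,F_2(g(x))-p^p(s(x))\bigr\}f_1(x)\,dx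 ,$$ and $g$ is *optimal* if it maximizes $U$ among all equal-bid functions. For an equal-bid function $g$ with strategy $s$ let $$R(x)=-\frac{\bigl[(p^w)'(s(x))F_2(g(x))+(p^p)'(s(x))\bigr]f_1(x)}{(p^w)'(s(x))F_1(x)+(p^p)'(s(x))},$$ $$h(x)=[x-p^w(s(x))]\,f_2(g(x))f_1(x)+f_1(x)\int_x^{a_2}R(t)\,dt ,\qquad x\in(a_1,a_2];$$ $R$ is the Lagrange multiplier determined by $\partial L/\partial s=0$, and $h=\partial L/\partial g$ is the derivative with respect to $g$ of the integrand $L$ of the Lagrangian. **Theorem.** (1) Let $g$ be optimal and let $L\subseteq(a_1,a_2]$ be a nonempty interval. - If $h>0$ on $L$ and $\sup L<a_2$, then $g(x)=\lim_{t\to(\sup L)^+}g(t)$ for all $x\in L$. If $h>0$ on $L$ and $\sup L=a_2$, then $g(x)=b_2$ for all $x\in L$. - If $h<0$ on $L$ and $\inf L>a_1$, then $g(x)=\lim_{t\to(\inf L)^-}g(t)$ for all $x\in L$. If $h<0$ on $L$ and $\inf L=a_1$, then $g(x)=0$ for all $x\in L$. (2) There is an optimal $g$ with $g(x)\in\{0\}\cup[b_1,b_2]$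 for all $x\in(a_1,a_2]$. -/

import Mathlib

open Set Filter Topology MeasureTheory

noncomputable section

/-- The data of a two-bidder rank-and-bid based auction with incomplete information:
the leader's type has density `f₁` on `[a₁, a₂]`, the follower's type has density `f₂` on
`[b₁, b₂]`; a bid `t` costs `pp t` in any case and a further `pw t` if it wins. -/
structure RankBidAuction where
  a₁ : ℝ
  a₂ : ℝ
  b₁ : ℝ
  b₂ : ℝ
  f₁ : ℝ → ℝ
  f₂ : ℝ → ℝ
  pw : ℝ → ℝ
  pp : ℝ → ℝ

namespace RankBidAuction

/-- The standing assumptions on the type densities and on the payment functions. Bids are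
nonnegative, so the payment functions are constrained on `[0, ∞)` only. -/
structure Standing (A : RankBidAuction) : Prop where
  a₁_nonneg : 0 ≤ A.a₁
  a₁_lt_a₂ : A.a₁ < A.a₂
  b₁_nonneg : 0 ≤ A.b₁
  b₁_lt_b₂ : A.b₁ < A.b₂
  /-- `f₁` is a probability density whose support is `[a₁, a₂]`. -/
  f₁_nonneg : ∀ x, 0 ≤ A.f₁ x
  f₁_eq_zero : ∀ x, x ∉ Icc A.a₁ A.a₂ → A.f₁ x = 0
  f₁_integrable : Integrable A.f₁
  f₁_integral : ∫ x, A.f₁ x = 1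
  f₁_support : ∀ c d, A.a₁ ≤ c → c < d → d ≤ A.a₂ → 0 < ∫ x in c..d, A.f₁ x
  /-- `f₂` is a probability density that vanishes off `[b₁, b₂]` and is continuous on it. -/
  f₂_nonneg : ∀ y, 0 ≤ A.f₂ y
  f₂_eq_zero : ∀ y, y ∉ Icc A.b₁ A.b₂ → A.f₂ y = 0
  f₂_continuousOn : ContinuousOn A.f₂ (Icc A.b₁ A.b₂)
  f₂_integral : ∫ y, A.f₂ y = 1
  /-- The payment functions. -/
  pw_zero : A.pw 0 = 0
  pp_zero : A.pp 0 = 0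
  pw_contDiff : ContDiff ℝ 1 A.pw
  pp_contDiff : ContDiff ℝ 1 A.pp
  deriv_pw_nonneg : ∀ t, 0 ≤ t → 0 ≤ deriv A.pw t
  deriv_pp_nonneg : ∀ t, 0 ≤ t → 0 ≤ deriv A.pp t
  deriv_pos : ∀ t, 0 ≤ t → 0 < deriv A.pw t + deriv A.pp t
  /-- Some bid costs its winner at least `b₂`. -/
  exists_high_bid : ∃ t, 0 ≤ t ∧ A.b₂ ≤ A.pw t + A.pp t

variable (A : RankBidAuction)

/-- The distribution function of the leader's type. -/
def F₁ (x : ℝ) : ℝ := ∫ t in Iic x, A.f₁ t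

/-- The distribution function of the follower's type. -/
def F₂ (y : ℝ) : ℝ := ∫ t in Iic y, A.f₂ t

/-- `g` is an equal-bid function: on `(a₁, a₂]` it is weakly increasing, left continuous and has
values in `[0, b₂]`. -/
structure IsEqualBid (g : ℝ → ℝ) : Prop where
  mem_Icc : ∀ x ∈ Ioc A.a₁ A.a₂, g x ∈ Icc 0 A.b₂
  monotoneOn : MonotoneOn g (Ioc A.a₁ A.a₂)
  leftContinuous : ∀ x ∈ Ioc A.a₁ A.a₂, ContinuousWithinAt g (Iic x) x

/-- `s` is the (nonnegative) leader strategy that belongs to `g`: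
`∫_{a₁}^x f₁ g = pw (s x) F₁[x] + pp (s x)` for `x ∈ (a₁, a₂]`. -/
def IsStrategyOf (g s : ℝ → ℝ) : Prop :=
  ∀ x ∈ Ioc A.a₁ A.a₂,
    0 ≤ s x ∧ ∫ t in A.a₁..x, A.f₁ t * g t = A.pw (s x) * A.F₁ x + A.pp (s x)

/-- The leader's expected utility when he follows `s` and wins with probability `F₂[g(x)]` at
type `x`. -/
def leaderUtility (g s : ℝ → ℝ) : ℝ :=
  ∫ x in A.a₁..A.a₂, ((x - A.pw (s x)) * A.F₂ (g x) - A.pp (s x)) * A.f₁ x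

/-- `(g, s)` is feasible and maximizes the leader's utility among all feasible pairs. -/
def IsOptimal (g s : ℝ → ℝ) : Prop :=
  A.IsEqualBid g ∧ A.IsStrategyOf g s ∧
    ∀ g' s', A.IsEqualBid g' → A.IsStrategyOf g' s' →
      A.leaderUtility g' s' ≤ A.leaderUtility g s

/-- The integrand of the Lagrangian with multiplier function `R`, at type `x`, as a function of
the bid `σ = s(x)` and of the equal-bid value `γ = g(x)`. -/
def lagrangian (R : ℝ → ℝ) (x σ γ : ℝ) : ℝ :=
  ((x - A.pw σ) * A.F₂ γ - A.pp σ) * A.f₁ x + γ * A.f₁ x * (∫ t in x..A.a₂, R t)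
    - (A.pw σ * A.F₁ x + A.pp σ) * R x

/-- The multiplier, the solution `R` of `∂L/∂s = 0`. -/
def multiplier (g s : ℝ → ℝ) (x : ℝ) : ℝ :=
  -((deriv A.pw (s x) * A.F₂ (g x) + deriv A.pp (s x)) * A.f₁ x) /
    (deriv A.pw (s x) * A.F₁ x + deriv A.pp (s x))

/-- The function `h = ∂L/∂g`, with the multiplier substituted. -/
def lagrangeDeriv (g s : ℝ → ℝ) (x : ℝ) : ℝ :=
  (x - A.pw (s x)) * A.f₂ (g x) * A.f₁ x
    + A.f₁ x * ∫ t in x..A.a₂, A.multiplier g s t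

theorem hasDerivAt_lagrangian_bid {g s : ℝ → ℝ} {x : ℝ}
    (hw : DifferentiableAt ℝ A.pw (s x)) (hp : DifferentiableAt ℝ A.pp (s x))
    (h0 : deriv A.pw (s x) * A.F₁ x + deriv A.pp (s x) ≠ 0) :
    HasDerivAt (fun σ => A.lagrangian (A.multiplier g s) x σ (g x)) 0 (s x) := by
  have h1 := hw.hasDerivAt
  have h2 := hp.hasDerivAt
  have key := ((((h1.const_sub x).mul_const (A.F₂ (g x))).sub h2).mul_const (A.f₁ x)).add_const
    (g x * A.f₁ x * (∫ t in x..A.a₂, A.multiplier g s t)) |>.sub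
    (((h1.mul_const (A.F₁ x)).add h2).mul_const (A.multiplier g s x))
  refine key.congr_deriv ?_
  unfold multiplier
  field_simp
  ring

theorem hasDerivAt_lagrangian_equalBid {g s : ℝ → ℝ} {x : ℝ}
    (hF : HasDerivAt A.F₂ (A.f₂ (g x)) (g x)) :
    HasDerivAt (fun γ => A.lagrangian (A.multiplier g s) x (s x) γ)
      (A.lagrangeDeriv g s x) (g x) := by
  have key := ((((hF.const_mul (x - A.pw (s x))).sub_const (A.pp (s x))).mul_const (A.f₁ x)).add
    (((hasDerivAt_id (g x)).mul_const (A.f₁ x)).mul_const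
      (∫ t in x..A.a₂, A.multiplier g s t))).sub_const
    ((A.pw (s x) * A.F₁ x + A.pp (s x)) * A.multiplier g s x)
  refine key.congr_deriv ?_
  unfold lagrangeDeriv
  ring

end RankBidAuction

end

/-! All integrals are taken against the atomless law f₁ dx on (a₁, a₂]. Part (1) is a
first-variation argument. Suppose an optimal g is perturbed by an amount of order m. The direct
effect on the utility comes through F₂(g). The indirect effect comes through the bids: the expected
payment pw(s)F₁ + pp(s) at type t changes by the integral of the perturbation over (a₁, t], and
implicit differentiation turns a payment change Γ m into a utility loss of `rate` · Γ m + o(m)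
(`tendsto_payment_quotients`, `tendsto_utility_quotient`). Here -`rate` · f₁ is the multiplier, so h
= f₁ · ((x - pw(s)) f₂(g) - `tailLoss`) by `lagrangeDeriv_eq`.

Equal-bid functions form a convex set, so g can be moved towards any g'. After Fubini the
directional derivative is the integral of (t - pw(s)) d - (g' - g) `tailLoss`, where d is the
derivative of F₂ in the direction g' - g (`directional`). It is nonpositive at an optimum. If h > 0
on L, raising g to the bound c imposed by the types above L makes the integrand nonnegative, and
positive wherever g < c; so g = c on L, except possibly at a least point of L. That point, and all
of L if L is a singleton, needs a needle variation: g is raised on short intervals (y, x] and the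
effect is divided by their mass (`needle`, `not_raisable`). If h < 0 on L, g is lowered to the bound
imposed from below; here left continuity turns a strict inequality at one point into one on an
interval.

F₂ may have kinks at b₁ and b₂, so only one-sided derivatives are used. At g = b₁ the left
derivative is 0 whatever f₂(b₁) is; lowering still pays because `tailLoss` > 0 below a₂, which holds
since the optimal utility is positive (`exists_utility_pos`, `tailLoss_pos`).

For part (2), a maximizing sequence has a limit by Helly's theorem and the utility passes to the
limit. Replacing the values of g up to b₁ by 0 leaves F₂(g) unchanged and lowers all bids. -/

namespace RankBidAuction

/-! ### The law of the leader's type and the distribution functions. -/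

variable (A : RankBidAuction)

/-- The law of the leader's type. -/
noncomputable def law : Measure ℝ :=
  (volume.restrict (Ioc A.a₁ A.a₂)).withDensity fun x => ENNReal.ofReal (A.f₁ x)

instance nullSingletonClass_law : NullSingletonClass A.law :=
  ⟨fun x => withDensity_absolutelyContinuous _ _ (measure_singleton x)⟩

variable {A}

theorem ae_law_of_forall {p : ℝ → Prop} (h : ∀ t ∈ Ioc A.a₁ A.a₂, p t) : ∀ᵐ t ∂A.law, p t := by
  have h1 : ∀ᵐ t ∂(volume.restrict (Ioc A.a₁ A.a₂)), p t :=
    (ae_restrict_mem measurableSet_Ioc).mono h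
  exact (withDensity_absolutelyContinuous _ _).ae_le h1

theorem ae_law_of_forall_Ioo {p : ℝ → Prop} (h : ∀ t ∈ Ioo A.a₁ A.a₂, p t) :
    ∀ᵐ t ∂A.law, p t := by
  have h1 : ∀ᵐ t ∂A.law, t ≠ A.a₂ := by
    simp [ae_iff]
  have h2 : ∀ᵐ t ∂A.law, t ∈ Ioc A.a₁ A.a₂ := ae_law_of_forall fun t ht => ht
  filter_upwards [h1, h2] with t ht ht'
  exact h t ⟨ht'.1, lt_of_le_of_ne ht'.2 ht⟩

theorem aestronglyMeasurable_law {φ : ℝ → ℝ}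
    (h : AEStronglyMeasurable φ (volume.restrict (Ioc A.a₁ A.a₂))) :
    AEStronglyMeasurable φ A.law :=
  h.mono_ac (withDensity_absolutelyContinuous _ _)

variable (hA : A.Standing)
include hA

theorem Standing.setIntegral_law {S : Set ℝ} (hS : MeasurableSet S) (φ : ℝ → ℝ) :
    ∫ x in S, φ x ∂A.law = ∫ x in S ∩ Ioc A.a₁ A.a₂, φ x * A.f₁ x := by
  rw [law, restrict_withDensity hS, Measure.restrict_restrict hS,
    integral_withDensity_eq_integral_toReal_smul₀]
  · refine integral_congr_ae (Eventually.of_forall fun x => ?_)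
    simp [ENNReal.toReal_ofReal (hA.f₁_nonneg x), mul_comm]
  · exact hA.f₁_integrable.aestronglyMeasurable.aemeasurable.ennreal_ofReal.restrict
  · exact Eventually.of_forall fun x => ENNReal.ofReal_lt_top

theorem Standing.integral_law (φ : ℝ → ℝ) :
    ∫ x, φ x ∂A.law = ∫ x in A.a₁..A.a₂, φ x * A.f₁ x := by
  rw [← setIntegral_univ, hA.setIntegral_law MeasurableSet.univ, univ_inter,
    intervalIntegral.integral_of_le hA.a₁_lt_a₂.le]

theorem Standing.isFiniteMeasure_law : IsFiniteMeasure A.law :=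
  isFiniteMeasure_withDensity_ofReal hA.f₁_integrable.restrict.2

theorem Standing.setIntegral_law_Ioc {c d : ℝ} (hc : A.a₁ ≤ c) (hcd : c ≤ d) (hd : d ≤ A.a₂)
    (φ : ℝ → ℝ) : ∫ x in Ioc c d, φ x ∂A.law = ∫ x in c..d, φ x * A.f₁ x := by
  rw [hA.setIntegral_law measurableSet_Ioc, intervalIntegral.integral_of_le hcd,
    inter_eq_left.2 (Ioc_subset_Ioc hc hd)]

theorem Standing.law_real_Ioc_pos {c d : ℝ} (hc : A.a₁ ≤ c) (hcd : c < d) (hd : d ≤ A.a₂) :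
    0 < A.law.real (Ioc c d) := by
  have h := hA.setIntegral_law_Ioc hc hcd.le hd (fun _ => 1)
  simp only [one_mul, setIntegral_const, smul_eq_mul, mul_one] at h
  rw [h]
  exact hA.f₁_support c d hc hcd hd

theorem Standing.integral_Iic_f₁ : ∀ x, A.a₁ ≤ x →
    ∫ t in Iic x, A.f₁ t = ∫ t in A.a₁..x, A.f₁ t := by
  intro x hx
  have h : ∫ t in Iic A.a₁, A.f₁ t = 0 := by
    rw [integral_Iic_eq_integral_Iio]
    refine setIntegral_eq_zero_of_forall_eq_zero fun t ht => hA.f₁_eq_zero t ?_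
    exact fun h => absurd h.1 (not_le.2 ht)
  have := intervalIntegral.integral_Iic_sub_Iic (f := A.f₁) (μ := volume) (a := A.a₁) (b := x)
    hA.f₁_integrable.integrableOn hA.f₁_integrable.integrableOn
  rw [← this, h, sub_zero]

theorem Standing.F₁_eq_law {x : ℝ} (hx : A.a₁ ≤ x) (hx2 : x ≤ A.a₂) :
    A.F₁ x = A.law.real (Ioc A.a₁ x) := by
  have h := hA.setIntegral_law_Ioc le_rfl hx hx2 (fun _ => 1)
  simp only [one_mul, setIntegral_const, smul_eq_mul, mul_one] at h
  rw [h, F₁, hA.integral_Iic_f₁ x hx]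

theorem Standing.F₁_pos {x : ℝ} (hx : x ∈ Ioc A.a₁ A.a₂) : 0 < A.F₁ x := by
  rw [hA.F₁_eq_law hx.1.le hx.2]
  exact hA.law_real_Ioc_pos le_rfl hx.1 hx.2

theorem Standing.F₁_le_one (x : ℝ) : A.F₁ x ≤ 1 := by
  rw [← hA.f₁_integral]
  exact setIntegral_le_integral hA.f₁_integrable (Eventually.of_forall hA.f₁_nonneg)

theorem Standing.F₁_mono : Monotone A.F₁ := fun _ _ h =>
  setIntegral_mono_set hA.f₁_integrable.integrableOn (Eventually.of_forall hA.f₁_nonneg)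
    (Eventually.of_forall (Iic_subset_Iic.2 h))

theorem Standing.law_univ : A.law.real univ = 1 := by
  have h := hA.integral_law (fun _ => 1)
  have h2 : A.F₁ A.a₂ = 1 := by
    rw [F₁, ← hA.f₁_integral]
    refine setIntegral_eq_integral_of_forall_compl_eq_zero fun t ht => hA.f₁_eq_zero t ?_
    exact fun h => ht h.2
  simp only [one_mul, integral_const, smul_eq_mul, mul_one] at h
  rw [h, ← hA.integral_Iic_f₁ _ hA.a₁_lt_a₂.le]
  exact h2

theorem Standing.integral_f₁_mul {x : ℝ} (hx : x ∈ Ioc A.a₁ A.a₂) (g : ℝ → ℝ) :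
    ∫ t in A.a₁..x, A.f₁ t * g t = ∫ t in Ioc A.a₁ x, g t ∂A.law := by
  rw [hA.setIntegral_law_Ioc le_rfl hx.1.le hx.2]
  simp only [mul_comm]

theorem Standing.leaderUtility_eq (g s : ℝ → ℝ) :
    A.leaderUtility g s = ∫ x, ((x - A.pw (s x)) * A.F₂ (g x) - A.pp (s x)) ∂A.law :=
  (hA.integral_law _).symm

/-- Bounded functions are integrable against the law of the leader's type. -/
theorem Standing.integrable_law {φ : ℝ → ℝ} (hm : AEStronglyMeasurable φ A.law) (C : ℝ)
    (hC : ∀ t ∈ Ioc A.a₁ A.a₂, |φ t| ≤ C) : Integrable φ A.law := by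
  have := hA.isFiniteMeasure_law
  exact Integrable.of_bound hm C (ae_law_of_forall hC)

theorem Standing.continuous_setIntegral_law {φ : ℝ → ℝ} (hφ : Integrable φ A.law) :
    Continuous fun x => ∫ t in Ioc A.a₁ x, φ t ∂A.law := by
  have h : ∀ x, ∫ t in Ioc A.a₁ x, φ t ∂A.law = ∫ t in A.a₁..x, φ t ∂A.law := by
    intro x
    rcases le_or_gt A.a₁ x with hx | hx
    · rw [intervalIntegral.integral_of_le hx]
    · rw [intervalIntegral.integral_of_ge hx.le, Ioc_eq_empty (by simpa using hx.le),
        hA.setIntegral_law measurableSet_Ioc]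
      have : Ioc x A.a₁ ∩ Ioc A.a₁ A.a₂ = ∅ := by
        ext t; simp only [mem_inter_iff, mem_Ioc, mem_empty_iff_false, iff_false]; grind
      simp [this]
  simp only [h]
  exact intervalIntegral.continuous_primitive (fun a b => hφ.intervalIntegrable) _

theorem Standing.continuousOn_F₁ : ContinuousOn A.F₁ (Icc A.a₁ A.a₂) := by
  have := hA.isFiniteMeasure_law
  have h := hA.continuous_setIntegral_law (integrable_const (1 : ℝ))
  refine h.continuousOn.congr fun x hx => ?_
  rw [hA.F₁_eq_law hx.1 hx.2]
  simp

theorem Standing.f₂_eq_indicator : A.f₂ = (Icc A.b₁ A.b₂).indicator A.f₂ :=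
  (indicator_eq_self.2 fun y hy => by_contra fun h => hy (hA.f₂_eq_zero y h)).symm

theorem Standing.integrable_f₂ : Integrable A.f₂ := by
  rw [hA.f₂_eq_indicator, integrable_indicator_iff measurableSet_Icc]
  exact hA.f₂_continuousOn.integrableOn_Icc

theorem Standing.measurable_f₂ : Measurable A.f₂ := by
  classical
  rw [hA.f₂_eq_indicator, ← piecewise_eq_indicator]
  exact hA.f₂_continuousOn.measurable_piecewise continuousOn_const measurableSet_Icc

theorem Standing.exists_f₂_le : ∃ M, 0 ≤ M ∧ ∀ y, A.f₂ y ≤ M := by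
  obtain ⟨M, hM⟩ := isCompact_Icc.bddAbove_image hA.f₂_continuousOn
  have h1 : ∀ y ∈ Icc A.b₁ A.b₂, A.f₂ y ≤ M := fun y hy => hM (mem_image_of_mem _ hy)
  have h0 : 0 ≤ M := (hA.f₂_nonneg _).trans (h1 A.b₁ ⟨le_rfl, hA.b₁_lt_b₂.le⟩)
  refine ⟨M, h0, fun y => ?_⟩
  by_cases hy : y ∈ Icc A.b₁ A.b₂
  · exact h1 y hy
  · rw [hA.f₂_eq_zero y hy]; exact h0

theorem Standing.F₂_sub (x y : ℝ) : A.F₂ y - A.F₂ x = ∫ t in x..y, A.f₂ t :=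
  intervalIntegral.integral_Iic_sub_Iic hA.integrable_f₂.integrableOn
    hA.integrable_f₂.integrableOn

theorem Standing.F₂_mono : Monotone A.F₂ := fun _ _ h =>
  setIntegral_mono_set hA.integrable_f₂.integrableOn (Eventually.of_forall hA.f₂_nonneg)
    (Eventually.of_forall (Iic_subset_Iic.2 h))

theorem Standing.F₂_nonneg (y : ℝ) : 0 ≤ A.F₂ y := integral_nonneg hA.f₂_nonneg

theorem Standing.F₂_le_one (x : ℝ) : A.F₂ x ≤ 1 := by
  rw [← hA.f₂_integral]
  exact setIntegral_le_integral hA.integrable_f₂ (Eventually.of_forall hA.f₂_nonneg)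

theorem Standing.abs_F₂_le (y : ℝ) : |A.F₂ y| ≤ 1 := by
  rw [abs_of_nonneg (hA.F₂_nonneg y)]; exact hA.F₂_le_one y

theorem Standing.F₂_eq_zero {y : ℝ} (hy : y ≤ A.b₁) : A.F₂ y = 0 := by
  rw [F₂, integral_Iic_eq_integral_Iio]
  refine setIntegral_eq_zero_of_forall_eq_zero fun t ht => hA.f₂_eq_zero t ?_
  exact fun h => absurd h.1 (not_le.2 (lt_of_lt_of_le ht hy))

theorem Standing.F₂_b₂ : A.F₂ A.b₂ = 1 := by
  rw [F₂, ← hA.f₂_integral]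
  exact setIntegral_eq_integral_of_forall_compl_eq_zero fun t ht =>
    hA.f₂_eq_zero t fun h => ht h.2

theorem Standing.exists_F₂_lipschitz : ∃ M, 0 ≤ M ∧ ∀ x y, |A.F₂ y - A.F₂ x| ≤ M * |y - x| := by
  obtain ⟨M, hM0, hM⟩ := hA.exists_f₂_le
  refine ⟨M, hM0, fun x y => ?_⟩
  rw [hA.F₂_sub]
  have := intervalIntegral.norm_integral_le_of_norm_le_const (f := A.f₂) (a := x) (b := y) (C := M)
    (fun t _ => by rw [Real.norm_eq_abs, abs_of_nonneg (hA.f₂_nonneg t)]; exact hM t)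
  simpa using this

theorem Standing.continuous_F₂ : Continuous A.F₂ := by
  obtain ⟨M, hM0, hM⟩ := hA.exists_F₂_lipschitz
  refine (LipschitzWith.of_dist_le_mul (K := ⟨M, hM0⟩) fun x y => ?_).continuous
  rw [Real.dist_eq, Real.dist_eq]
  exact hM y x

theorem Standing.F₂_eq_integral (y : ℝ) : A.F₂ y = A.F₂ A.b₁ + ∫ t in A.b₁..y, A.f₂ t := by
  rw [← hA.F₂_sub]; ring

/-- Below b₂ the density f₂ is continuous from the right, even at b₁, where it may jump up from 0.
This is the derivative relevant for raising g. -/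
theorem Standing.hasDerivWithinAt_F₂_Ici {y : ℝ} (hy : y < A.b₂) :
    HasDerivWithinAt A.F₂ (A.f₂ y) (Ici y) y := by
  rw [funext hA.F₂_eq_integral]
  refine HasDerivWithinAt.const_add _ ?_
  refine intervalIntegral.integral_hasDerivWithinAt_right (t := Ioi y)
    hA.integrable_f₂.intervalIntegrable
    hA.measurable_f₂.stronglyMeasurable.stronglyMeasurableAtFilter ?_
  rcases lt_or_ge y A.b₁ with h | h
  · refine (continuousAt_const (y := (0 : ℝ)).congr ?_).continuousWithinAt
    filter_upwards [Iio_mem_nhds h] with t ht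
    exact (hA.f₂_eq_zero t fun h' => absurd h'.1 (not_le.2 ht)).symm
  · refine (hA.f₂_continuousOn y ⟨h, hy.le⟩).mono_of_mem_nhdsWithin ?_
    filter_upwards [Ioo_mem_nhdsGT hy] with t ht
    exact ⟨h.trans ht.1.le, ht.2.le⟩

/-- The case distinction is needed at y = b₁ only: F₂ vanishes to the left, while f₂(b₁) may be
positive. This is the derivative relevant for lowering g. -/
theorem Standing.hasDerivWithinAt_F₂_Iic {y : ℝ} (hy : y ≤ A.b₂) :
    HasDerivWithinAt A.F₂ (if y ≤ A.b₁ then 0 else A.f₂ y) (Iic y) y := by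
  split_ifs with h
  · refine (hasDerivWithinAt_const y (Iic y) (0 : ℝ)).congr (fun t ht => ?_) ?_
    · exact hA.F₂_eq_zero (le_trans ht h)
    · exact hA.F₂_eq_zero h
  · push Not at h
    rw [funext hA.F₂_eq_integral]
    refine HasDerivWithinAt.const_add _ ?_
    refine intervalIntegral.integral_hasDerivWithinAt_right (t := Iic y)
      hA.integrable_f₂.intervalIntegrable
      hA.measurable_f₂.stronglyMeasurable.stronglyMeasurableAtFilter ?_
    refine (hA.f₂_continuousOn y ⟨h.le, hy⟩).mono_of_mem_nhdsWithin ?_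
    filter_upwards [Ioc_mem_nhdsLE h] with t ht
    exact ⟨ht.1.le, ht.2.trans hy⟩

end RankBidAuction

namespace RankBidAuction

variable {A : RankBidAuction}

/-! ### Payment functions and the dependence of the bid on its cost. -/

section Payments

variable (hA : A.Standing)
include hA

theorem Standing.differentiable_pw : Differentiable ℝ A.pw :=
  hA.pw_contDiff.differentiable one_ne_zero

theorem Standing.differentiable_pp : Differentiable ℝ A.pp :=
  hA.pp_contDiff.differentiable one_ne_zero

theorem Standing.continuous_deriv_pw : Continuous (deriv A.pw) :=
  hA.pw_contDiff.continuous_deriv le_rfl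

theorem Standing.continuous_deriv_pp : Continuous (deriv A.pp) :=
  hA.pp_contDiff.continuous_deriv le_rfl

theorem Standing.monotoneOn_pw : MonotoneOn A.pw (Ici 0) :=
  monotoneOn_of_deriv_nonneg (convex_Ici 0) hA.differentiable_pw.continuous.continuousOn
    hA.differentiable_pw.differentiableOn fun t ht => hA.deriv_pw_nonneg t (interior_subset ht)

theorem Standing.monotoneOn_pp : MonotoneOn A.pp (Ici 0) :=
  monotoneOn_of_deriv_nonneg (convex_Ici 0) hA.differentiable_pp.continuous.continuousOn
    hA.differentiable_pp.differentiableOn fun t ht => hA.deriv_pp_nonneg t (interior_subset ht)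

theorem Standing.pw_nonneg {t : ℝ} (ht : 0 ≤ t) : 0 ≤ A.pw t := by
  rw [← hA.pw_zero]; exact hA.monotoneOn_pw (mem_Ici.2 le_rfl) ht ht

theorem Standing.pp_nonneg {t : ℝ} (ht : 0 ≤ t) : 0 ≤ A.pp t := by
  rw [← hA.pp_zero]; exact hA.monotoneOn_pp (mem_Ici.2 le_rfl) ht ht

theorem Standing.deriv_pos_of_weight {t w : ℝ} (ht : 0 ≤ t) (hw : 0 < w) :
    0 < deriv A.pw t * w + deriv A.pp t := by
  have h1 := hA.deriv_pw_nonneg t ht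
  have h2 := hA.deriv_pp_nonneg t ht
  have h3 := hA.deriv_pos t ht
  rcases h1.eq_or_lt with h | h
  · rw [← h] at h3 ⊢; linarith
  · have := mul_pos h hw; linarith

theorem Standing.hasDerivAt_payment (w t : ℝ) :
    HasDerivAt (fun σ => A.pw σ * w + A.pp σ) (deriv A.pw t * w + deriv A.pp t) t :=
  ((hA.differentiable_pw t).hasDerivAt.mul_const w).add (hA.differentiable_pp t).hasDerivAt

theorem Standing.strictMonoOn_payment {w : ℝ} (hw : 0 < w) :
    StrictMonoOn (fun σ => A.pw σ * w + A.pp σ) (Ici 0) := by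
  refine strictMonoOn_of_deriv_pos (convex_Ici 0) ?_ fun t ht => ?_
  · exact fun t _ => (hA.hasDerivAt_payment w t).continuousAt.continuousWithinAt
  · rw [(hA.hasDerivAt_payment w t).deriv]
    exact hA.deriv_pos_of_weight (mem_Ici.1 (interior_subset ht)) hw

/-- The bid depends continuously on its expected cost. -/
theorem Standing.tendsto_bid {ι : Type*} {l : Filter ι} {w σ : ι → ℝ} {w₀ σ₀ : ℝ}
    (hw₀ : 0 < w₀) (hσ₀ : 0 ≤ σ₀) (hσ : ∀ᶠ i in l, 0 ≤ σ i) (hw : Tendsto w l (𝓝 w₀))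
    (h : Tendsto (fun i => A.pw (σ i) * w i + A.pp (σ i)) l (𝓝 (A.pw σ₀ * w₀ + A.pp σ₀))) :
    Tendsto σ l (𝓝 σ₀) := by
  have hpos : ∀ᶠ i in l, 0 < w i := hw.eventually (lt_mem_nhds hw₀)
  have hc : ∀ c, Tendsto (fun i => A.pw c * w i + A.pp c) l (𝓝 (A.pw c * w₀ + A.pp c)) :=
    fun c => (hw.const_mul _).add_const _
  -- A fixed bid c ≠ σ₀ is compared with σ i through their costs: the cost of c under w i converges
  -- to its cost under w₀, so a strict inequality between the limits holds eventually, and strict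
  -- monotonicity of the cost carries it back to the bids.
  refine tendsto_order.2 ⟨fun c hcσ => ?_, fun c hcσ => ?_⟩
  · rcases lt_or_ge c 0 with h0 | h0
    · filter_upwards [hσ] with i hi using h0.trans_le hi
    · filter_upwards [hσ, hpos,
        (hc c).eventually_lt h (hA.strictMonoOn_payment hw₀ h0 hσ₀ hcσ)] with i h1 h2 h3
      exact ((hA.strictMonoOn_payment h2).lt_iff_lt h0 h1).1 h3
  · have h0 : 0 ≤ c := hσ₀.trans hcσ.le
    filter_upwards [hσ, hpos,
      h.eventually_lt (hc c) (hA.strictMonoOn_payment hw₀ hσ₀ h0 hcσ)] with i h1 h2 h3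
    exact ((hA.strictMonoOn_payment h2).lt_iff_lt h1 h0).1 h3

/-- Both payments increase with the bid, so for w > 0 their changes cannot cancel in the total cost.
Together with `abs_pp_sub_le` this supplies the bounds for dominated convergence. -/
theorem Standing.abs_pw_sub_le {w s s' : ℝ} (hs : 0 ≤ s) (hs' : 0 ≤ s') :
    |A.pw s' - A.pw s| * w ≤ |(A.pw s' * w + A.pp s') - (A.pw s * w + A.pp s)| := by
  rcases le_total s s' with h | h
  · have h1 := hA.monotoneOn_pw (mem_Ici.2 hs) (mem_Ici.2 hs') h
    have h2 := hA.monotoneOn_pp (mem_Ici.2 hs) (mem_Ici.2 hs') h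
    rw [abs_of_nonneg (sub_nonneg.2 h1)]
    refine le_trans ?_ (le_abs_self _)
    linarith
  · have h1 := hA.monotoneOn_pw (mem_Ici.2 hs') (mem_Ici.2 hs) h
    have h2 := hA.monotoneOn_pp (mem_Ici.2 hs') (mem_Ici.2 hs) h
    rw [abs_of_nonpos (sub_nonpos.2 h1)]
    refine le_trans ?_ (neg_le_abs _)
    linarith

theorem Standing.abs_pp_sub_le {w s s' : ℝ} (hs : 0 ≤ s) (hs' : 0 ≤ s') (hw : 0 < w) :
    |A.pp s' - A.pp s| ≤ |(A.pw s' * w + A.pp s') - (A.pw s * w + A.pp s)| := by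
  rcases le_total s s' with h | h
  · have h1 := mul_le_mul_of_nonneg_right
      (hA.monotoneOn_pw (mem_Ici.2 hs) (mem_Ici.2 hs') h) hw.le
    have h2 := hA.monotoneOn_pp (mem_Ici.2 hs) (mem_Ici.2 hs') h
    rw [abs_of_nonneg (sub_nonneg.2 h2)]
    refine le_trans ?_ (le_abs_self _)
    linarith
  · have h1 := mul_le_mul_of_nonneg_right
      (hA.monotoneOn_pw (mem_Ici.2 hs') (mem_Ici.2 hs) h) hw.le
    have h2 := hA.monotoneOn_pp (mem_Ici.2 hs') (mem_Ici.2 hs) h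
    rw [abs_of_nonpos (sub_nonpos.2 h2)]
    refine le_trans ?_ (neg_le_abs _)
    linarith

end Payments

/-! ### Existence, bounds and integrability of strategies. -/

section Strategies

variable {g s : ℝ → ℝ}

theorem IsEqualBid.aestronglyMeasurable (hg : A.IsEqualBid g) :
    AEStronglyMeasurable g A.law :=
  aestronglyMeasurable_law
    (aemeasurable_restrict_of_monotoneOn measurableSet_Ioc hg.monotoneOn).aestronglyMeasurable

theorem IsEqualBid.integrable (hg : A.IsEqualBid g) (hA : A.Standing) : Integrable g A.law :=
  hA.integrable_law hg.aestronglyMeasurable A.b₂ fun t ht => by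
    rw [abs_of_nonneg (hg.mem_Icc t ht).1]; exact (hg.mem_Icc t ht).2

theorem IsStrategyOf.payment_eq (hs : A.IsStrategyOf g s) (hA : A.Standing) {x : ℝ}
    (hx : x ∈ Ioc A.a₁ A.a₂) :
    A.pw (s x) * A.F₁ x + A.pp (s x) = ∫ t in Ioc A.a₁ x, g t ∂A.law := by
  rw [← hA.integral_f₁_mul hx, (hs x hx).2]

theorem IsStrategyOf.continuousOn (hs : A.IsStrategyOf g s) (hg : A.IsEqualBid g)
    (hA : A.Standing) : ContinuousOn s (Ioc A.a₁ A.a₂) := by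
  intro x hx
  refine hA.tendsto_bid (w := A.F₁) (hA.F₁_pos hx) (hs x hx).1 ?_ ?_ ?_
  · filter_upwards [self_mem_nhdsWithin] with t ht using (hs t ht).1
  · exact (hA.continuousOn_F₁.mono Ioc_subset_Icc_self) x hx
  · rw [hs.payment_eq hA hx]
    refine ((hA.continuous_setIntegral_law (hg.integrable hA)).continuousWithinAt).congr' ?_
    filter_upwards [self_mem_nhdsWithin] with t ht using (hs.payment_eq hA ht).symm

theorem IsEqualBid.setIntegral_nonneg (hg : A.IsEqualBid g) {S : Set ℝ} :
    0 ≤ ∫ t in S, g t ∂A.law :=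
  integral_nonneg_of_ae (ae_restrict_of_ae (ae_law_of_forall fun t ht => (hg.mem_Icc t ht).1))

theorem IsEqualBid.setIntegral_le (hg : A.IsEqualBid g) (hA : A.Standing) (S : Set ℝ) :
    ∫ t in S, g t ∂A.law ≤ A.b₂ * A.law.real S := by
  have := hA.isFiniteMeasure_law
  have h : ∫ t in S, g t ∂A.law ≤ ∫ t in S, A.b₂ ∂A.law :=
    integral_mono_ae (hg.integrable hA).restrict (integrable_const _)
      (ae_restrict_of_ae (ae_law_of_forall fun t ht => (hg.mem_Icc t ht).2))
  rwa [setIntegral_const, smul_eq_mul, mul_comm] at h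

theorem Standing.b₂_mul_F₁_le (hA : A.Standing) {T : ℝ} (hT0 : 0 ≤ T)
    (hT : A.b₂ ≤ A.pw T + A.pp T) {x : ℝ} (hx : x ∈ Ioc A.a₁ A.a₂) :
    A.b₂ * A.F₁ x ≤ A.pw T * A.F₁ x + A.pp T := by
  have h1 := mul_le_mul_of_nonneg_right hT (hA.F₁_pos hx).le
  have h2 := mul_le_mul_of_nonneg_left (hA.F₁_le_one x) (hA.pp_nonneg hT0)
  linarith

/-- Intermediate value theorem: bid 0 costs nothing, and a bid T with pw(T) + pp(T) ≥ b₂ has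
expected cost at least b₂ F₁(x), which bounds the integral of g. -/
theorem IsEqualBid.exists_strategy (hg : A.IsEqualBid g) (hA : A.Standing) :
    ∃ s, A.IsStrategyOf g s := by
  obtain ⟨T, hT0, hT⟩ := hA.exists_high_bid
  have key : ∀ x ∈ Ioc A.a₁ A.a₂, ∃ σ, 0 ≤ σ ∧
      ∫ t in A.a₁..x, A.f₁ t * g t = A.pw σ * A.F₁ x + A.pp σ := by
    intro x hx
    have hc : ContinuousOn (fun σ => A.pw σ * A.F₁ x + A.pp σ) (Icc 0 T) :=
      fun t _ => (hA.hasDerivAt_payment _ t).continuousAt.continuousWithinAt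
    have hmem : ∫ t in A.a₁..x, A.f₁ t * g t ∈
        Icc (A.pw 0 * A.F₁ x + A.pp 0) (A.pw T * A.F₁ x + A.pp T) := by
      rw [hA.integral_f₁_mul hx, hA.pw_zero, hA.pp_zero, zero_mul, zero_add]
      refine ⟨hg.setIntegral_nonneg, (hg.setIntegral_le hA _).trans ?_⟩
      rw [← hA.F₁_eq_law hx.1.le hx.2]
      exact hA.b₂_mul_F₁_le hT0 hT hx
    obtain ⟨σ, hσ, h⟩ := intermediate_value_Icc hT0 hc hmem
    exact ⟨σ, hσ.1, h.symm⟩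
  choose! s hs using key
  exact ⟨s, hs⟩

/-- All strategies are bounded by one and the same bid. -/
theorem Standing.exists_bid_bound (hA : A.Standing) :
    ∃ T, 0 ≤ T ∧ ∀ g s, A.IsEqualBid g → A.IsStrategyOf g s →
      ∀ x ∈ Ioc A.a₁ A.a₂, s x ∈ Icc 0 T := by
  obtain ⟨T, hT0, hT⟩ := hA.exists_high_bid
  refine ⟨T, hT0, fun g s hg hs x hx => ⟨(hs x hx).1, ?_⟩⟩
  refine ((hA.strictMonoOn_payment (hA.F₁_pos hx)).le_iff_le (hs x hx).1 hT0).1 ?_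
  rw [hs.payment_eq hA hx]
  refine (hg.setIntegral_le hA _).trans ?_
  rw [← hA.F₁_eq_law hx.1.le hx.2]
  exact hA.b₂_mul_F₁_le hT0 hT hx

theorem Standing.exists_payment_bound (hA : A.Standing) :
    ∃ K, 0 ≤ K ∧ ∀ g s, A.IsEqualBid g → A.IsStrategyOf g s →
      ∀ x ∈ Ioc A.a₁ A.a₂, 0 ≤ A.pw (s x) ∧ 0 ≤ A.pp (s x) ∧
        |A.pp (s x)| ≤ K ∧ |x - A.pw (s x)| ≤ K := by
  obtain ⟨T, hT0, hT⟩ := hA.exists_bid_bound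
  have h0 : 0 ≤ A.a₂ := hA.a₁_nonneg.trans hA.a₁_lt_a₂.le
  have h1 := hA.pw_nonneg hT0
  have h2 := hA.pp_nonneg hT0
  refine ⟨A.a₂ + A.pw T + A.pp T, by positivity, fun g s hg hs x hx => ?_⟩
  have h3 := hT g s hg hs x hx
  have h4 := hA.pw_nonneg h3.1
  have h5 := hA.pp_nonneg h3.1
  have h6 := hA.monotoneOn_pw (mem_Ici.2 h3.1) (mem_Ici.2 hT0) h3.2
  have h7 := hA.monotoneOn_pp (mem_Ici.2 h3.1) (mem_Ici.2 hT0) h3.2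
  have h8 := hA.a₁_nonneg.trans hx.1.le
  have h9 := hx.2
  refine ⟨h4, h5, ?_, ?_⟩ <;> rw [abs_le] <;> constructor <;> linarith

theorem IsStrategyOf.aestronglyMeasurable_comp (hs : A.IsStrategyOf g s) (hg : A.IsEqualBid g)
    (hA : A.Standing) {φ : ℝ → ℝ} (hφ : Continuous φ) :
    AEStronglyMeasurable (fun x => φ (s x)) A.law :=
  aestronglyMeasurable_law
    ((hφ.comp_continuousOn (hs.continuousOn hg hA)).aestronglyMeasurable measurableSet_Ioc)

theorem IsEqualBid.aestronglyMeasurable_F₂ (hg : A.IsEqualBid g) (hA : A.Standing) :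
    AEStronglyMeasurable (fun x => A.F₂ (g x)) A.law :=
  hA.continuous_F₂.comp_aestronglyMeasurable hg.aestronglyMeasurable

theorem IsStrategyOf.aestronglyMeasurable_margin (hs : A.IsStrategyOf g s)
    (hg : A.IsEqualBid g) (hA : A.Standing) :
    AEStronglyMeasurable (fun x => x - A.pw (s x)) A.law :=
  aestronglyMeasurable_id.sub
    (hs.aestronglyMeasurable_comp hg hA hA.differentiable_pw.continuous)

theorem IsStrategyOf.integrable_utility (hs : A.IsStrategyOf g s) (hg : A.IsEqualBid g)
    (hA : A.Standing) :
    Integrable (fun x => (x - A.pw (s x)) * A.F₂ (g x) - A.pp (s x)) A.law := by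
  obtain ⟨K, hK0, hK⟩ := hA.exists_payment_bound
  refine hA.integrable_law (((hs.aestronglyMeasurable_margin hg hA).mul
    (hg.aestronglyMeasurable_F₂ hA)).sub
    (hs.aestronglyMeasurable_comp hg hA hA.differentiable_pp.continuous)) (K * 1 + K) ?_
  intro t ht
  obtain ⟨-, -, h3, h4⟩ := hK g s hg hs t ht
  refine (abs_sub _ _).trans (add_le_add ?_ h3)
  rw [abs_mul]
  exact mul_le_mul h4 (hA.abs_F₂_le _) (abs_nonneg _) hK0

end Strategies

/-! ### The multiplier and the tail loss. -/

section Multiplier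

variable (A) in
/-- The marginal loss from a higher expected payment, per unit of `f₁`: the multiplier is
`-rate * f₁`. -/
noncomputable def rate (g s : ℝ → ℝ) (t : ℝ) : ℝ :=
  (deriv A.pw (s t) * A.F₂ (g t) + deriv A.pp (s t)) /
    (deriv A.pw (s t) * A.F₁ t + deriv A.pp (s t))

variable (A) in
/-- The loss of the types above `x` from a higher equal bid of type `x`. -/
noncomputable def tailLoss (g s : ℝ → ℝ) (x : ℝ) : ℝ := ∫ t in Ioc x A.a₂, A.rate g s t ∂A.law

variable {g s : ℝ → ℝ}

/-- Since f₁ ≥ 0 factors out, a strict sign of h is a strict sign of the bracket, and f₁ plays no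
further role pointwise. -/
theorem Standing.lagrangeDeriv_eq (hA : A.Standing) {x : ℝ} (hx : x ∈ Ioc A.a₁ A.a₂) :
    A.lagrangeDeriv g s x =
      A.f₁ x * ((x - A.pw (s x)) * A.f₂ (g x) - A.tailLoss g s x) := by
  have h : ∫ t in x..A.a₂, A.multiplier g s t = -A.tailLoss g s x := by
    rw [tailLoss, hA.setIntegral_law_Ioc hx.1.le hx.2 le_rfl, ← intervalIntegral.integral_neg]
    refine intervalIntegral.integral_congr fun t _ => ?_
    simp only [multiplier, rate]
    ring
  rw [lagrangeDeriv, h]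
  ring

variable (hg : A.IsEqualBid g) (hs : A.IsStrategyOf g s) (hA : A.Standing)
include hg hs hA

theorem IsStrategyOf.aestronglyMeasurable_rate : AEStronglyMeasurable (A.rate g s) A.law := by
  have hF : AEStronglyMeasurable A.F₁ A.law :=
    hA.F₁_mono.measurable.aestronglyMeasurable
  have h1 := hs.aestronglyMeasurable_comp hg hA hA.continuous_deriv_pw
  have h2 := hs.aestronglyMeasurable_comp hg hA hA.continuous_deriv_pp
  exact (((h1.mul (hg.aestronglyMeasurable_F₂ hA)).add h2).aemeasurable.div
    ((h1.mul hF).add h2).aemeasurable).aestronglyMeasurable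

omit hg in
theorem IsStrategyOf.rate_nonneg {t : ℝ} (ht : t ∈ Ioc A.a₁ A.a₂) : 0 ≤ A.rate g s t := by
  have h0 := (hs t ht).1
  refine div_nonneg ?_ (hA.deriv_pos_of_weight h0 (hA.F₁_pos ht)).le
  exact add_nonneg (mul_nonneg (hA.deriv_pw_nonneg _ h0) (hA.F₂_nonneg _))
    (hA.deriv_pp_nonneg _ h0)

omit hg in
theorem IsStrategyOf.rate_pos {t : ℝ} (ht : t ∈ Ioc A.a₁ A.a₂) (hF : 0 < A.F₂ (g t)) :
    0 < A.rate g s t :=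
  div_pos (hA.deriv_pos_of_weight (hs t ht).1 hF)
    (hA.deriv_pos_of_weight (hs t ht).1 (hA.F₁_pos ht))

omit hg in
-- The rate itself may blow up at a₁, where F₁ tends to 0. Only this product is bounded uniformly;
-- it suffices because a bounded perturbation changes the expected payment of type t by O(F₁(t)).
theorem IsStrategyOf.rate_mul_F₁_le {t : ℝ} (ht : t ∈ Ioc A.a₁ A.a₂) :
    A.rate g s t * A.F₁ t ≤ 1 := by
  have h0 := (hs t ht).1
  have hF := hA.F₁_pos ht
  have h1 := hA.deriv_pw_nonneg _ h0
  have h2 := hA.deriv_pp_nonneg _ h0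
  rw [rate, div_mul_eq_mul_div, div_le_one (hA.deriv_pos_of_weight h0 hF), add_mul]
  refine add_le_add ?_ (mul_le_of_le_one_right h2 (hA.F₁_le_one t))
  exact mul_le_mul_of_nonneg_right (mul_le_of_le_one_right h1 (hA.F₂_le_one _)) hF.le

theorem IsStrategyOf.integrableOn_rate {x : ℝ} (hx : A.a₁ < x) :
    IntegrableOn (A.rate g s) (Ioc x A.a₂) A.law := by
  rcases lt_or_ge A.a₂ x with hx2 | hx2
  · rw [Ioc_eq_empty (by simpa using hx2.le)]; exact integrableOn_empty
  have hxm : x ∈ Ioc A.a₁ A.a₂ := ⟨hx, hx2⟩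
  rw [← integrable_indicator_iff measurableSet_Ioc]
  refine hA.integrable_law
    ((hs.aestronglyMeasurable_rate hg hA).indicator measurableSet_Ioc) (1 / A.F₁ x) ?_
  intro t ht
  have hpos := hA.F₁_pos hxm
  by_cases h : t ∈ Ioc x A.a₂
  · rw [indicator_of_mem h, abs_of_nonneg (hs.rate_nonneg hA ht), le_div_iff₀ hpos]
    exact (mul_le_mul_of_nonneg_left (hA.F₁_mono h.1.le) (hs.rate_nonneg hA ht)).trans
      (hs.rate_mul_F₁_le hA ht)
  · rw [indicator_of_notMem h, abs_zero]; positivity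

end Multiplier

end RankBidAuction

namespace RankBidAuction

variable {A : RankBidAuction}

/-! ### First-order expansion of the utility. -/

section Expansion

variable (hA : A.Standing) {g s : ℝ → ℝ}
include hA

/-- The first-order effect of a small change of the expected payment. -/
theorem Standing.tendsto_payment_quotients {w σ₀ γ : ℝ} {σ m : ℕ → ℝ} (hw : 0 < w)
    (hσ₀ : 0 ≤ σ₀) (hσ : ∀ n, 0 ≤ σ n) (hm0 : Tendsto m atTop (𝓝 0)) (hm : ∀ n, 0 < m n)
    (h : Tendsto (fun n => ((A.pw (σ n) * w + A.pp (σ n)) - (A.pw σ₀ * w + A.pp σ₀)) / m n)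
      atTop (𝓝 γ)) :
    Tendsto (fun n => (A.pw (σ n) - A.pw σ₀) / m n) atTop
        (𝓝 (deriv A.pw σ₀ * (γ / (deriv A.pw σ₀ * w + deriv A.pp σ₀)))) ∧
      Tendsto (fun n => (A.pp (σ n) - A.pp σ₀) / m n) atTop
        (𝓝 (deriv A.pp σ₀ * (γ / (deriv A.pw σ₀ * w + deriv A.pp σ₀)))) := by
  set H : ℝ → ℝ := fun t => A.pw t * w + A.pp t with hH
  have hD := hA.deriv_pos_of_weight hσ₀ hw
  have hlim : Tendsto (fun n => H (σ n)) atTop (𝓝 (H σ₀)) := by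
    have h1 := (h.mul hm0).add_const (H σ₀)
    rw [mul_zero, zero_add] at h1
    refine h1.congr fun n => ?_
    rw [div_mul_cancel₀ _ (hm n).ne']
    simp only [hH]; ring
  have hσt : Tendsto σ atTop (𝓝 σ₀) :=
    hA.tendsto_bid (w := fun _ => w) hw hσ₀ (Eventually.of_forall hσ) tendsto_const_nhds hlim
  -- Writing increments as `dslope` times σ n - σ₀ avoids division by σ n - σ₀, which may be 0; σ n
  -- - σ₀ is then recovered from the increment of the cost H, whose slope has a positive limit.
  have hslope : ∀ {φ : ℝ → ℝ}, DifferentiableAt ℝ φ σ₀ →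
      Tendsto (fun n => dslope φ σ₀ (σ n)) atTop (𝓝 (deriv φ σ₀)) := by
    intro φ hφ
    have := (continuousAt_dslope_same.2 hφ).tendsto.comp hσt
    rwa [dslope_same] at this
  have hid : ∀ (φ : ℝ → ℝ) n, φ (σ n) - φ σ₀ = dslope φ σ₀ (σ n) * (σ n - σ₀) := by
    intro φ n
    rw [← sub_smul_dslope φ σ₀ (σ n), smul_eq_mul, mul_comm]
  have hHd := hA.hasDerivAt_payment w σ₀
  have hHs := hslope hHd.differentiableAt
  rw [hHd.deriv] at hHs
  have hq : Tendsto (fun n => (σ n - σ₀) / m n) atTop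
      (𝓝 (γ / (deriv A.pw σ₀ * w + deriv A.pp σ₀))) := by
    refine (h.div hHs hD.ne').congr' ?_
    filter_upwards [hHs.eventually (lt_mem_nhds hD)] with n hn
    have h2 := hid H n
    simp only [hH, Pi.div_apply] at h2 hn ⊢
    rw [h2, div_right_comm, mul_div_cancel_left₀ _ hn.ne']
  constructor
  · refine ((hslope (hA.differentiable_pw σ₀)).mul hq).congr fun n => ?_
    rw [hid A.pw n, mul_div_assoc]
  · refine ((hslope (hA.differentiable_pp σ₀)).mul hq).congr fun n => ?_
    rw [hid A.pp n, mul_div_assoc]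

/-- First-order expansion of the utility along a sequence of perturbations of size `m n`,
up to the direct effect of the perturbation on the winning probability. -/
theorem Standing.tendsto_utility_quotient (hg : A.IsEqualBid g) (hs : A.IsStrategyOf g s)
    {gn sn : ℕ → ℝ → ℝ} (hgn : ∀ n, A.IsEqualBid (gn n)) (hsn : ∀ n, A.IsStrategyOf (gn n) (sn n))
    {m : ℕ → ℝ} (hm : ∀ n, 0 < m n) (hm0 : Tendsto m atTop (𝓝 0)) {C : ℝ}
    (hC : ∀ n, ∀ t ∈ Ioc A.a₁ A.a₂,
      |∫ u in Ioc A.a₁ t, gn n u ∂A.law - ∫ u in Ioc A.a₁ t, g u ∂A.law| ≤ C * m n * A.F₁ t)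
    {Γ : ℝ → ℝ} (hΓ : ∀ t ∈ Ioo A.a₁ A.a₂, Tendsto (fun n =>
      (∫ u in Ioc A.a₁ t, gn n u ∂A.law - ∫ u in Ioc A.a₁ t, g u ∂A.law) / m n) atTop (𝓝 (Γ t)))
    (hF : ∀ᵐ t ∂A.law, Tendsto (fun n => A.F₂ (gn n t)) atTop (𝓝 (A.F₂ (g t)))) :
    Tendsto (fun n => (A.leaderUtility (gn n) (sn n) - A.leaderUtility g s
        - ∫ t, (t - A.pw (s t)) * (A.F₂ (gn n t) - A.F₂ (g t)) ∂A.law) / m n) atTop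
      (𝓝 (-∫ t, A.rate g s t * Γ t ∂A.law)) := by
  have hfin := hA.isFiniteMeasure_law
  obtain ⟨K, hK0, hK⟩ := hA.exists_payment_bound
  have hC0 : 0 ≤ C := by
    have ha : A.a₂ ∈ Ioc A.a₁ A.a₂ := ⟨hA.a₁_lt_a₂, le_rfl⟩
    have h1 := (abs_nonneg _).trans (hC 0 _ ha)
    by_contra hneg
    push Not at hneg
    have := mul_pos (hm 0) (hA.F₁_pos ha)
    nlinarith
  -- Once the direct effect is subtracted, the bid-induced change is -(pw(sₙ) - pw(s)) F₂(gₙ) -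
  -- (pp(sₙ) - pp(s)).
  set D : ℕ → ℝ → ℝ := fun n t =>
    (-((A.pw (sn n t) - A.pw (s t)) / m n * A.F₂ (gn n t)) - (A.pp (sn n t) - A.pp (s t)) / m n)
    with hDdef
  have hmeasF : ∀ n, AEStronglyMeasurable (fun t => A.F₂ (gn n t) - A.F₂ (g t)) A.law := fun n =>
    ((hgn n).aestronglyMeasurable_F₂ hA).sub (hg.aestronglyMeasurable_F₂ hA)
  have heq : ∀ n, (A.leaderUtility (gn n) (sn n) - A.leaderUtility g s
        - ∫ t, (t - A.pw (s t)) * (A.F₂ (gn n t) - A.F₂ (g t)) ∂A.law) / m n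
      = ∫ t, D n t ∂A.law := by
    intro n
    have hi : Integrable (fun t => (t - A.pw (s t)) * (A.F₂ (gn n t) - A.F₂ (g t))) A.law := by
      refine hA.integrable_law ((hs.aestronglyMeasurable_margin hg hA).mul (hmeasF n))
        (K * (1 + 1)) fun t ht => ?_
      rw [abs_mul]
      refine mul_le_mul (hK g s hg hs t ht).2.2.2 ?_ (abs_nonneg _) hK0
      exact (abs_sub _ _).trans (add_le_add (hA.abs_F₂_le _) (hA.abs_F₂_le _))
    have hd : Integrable (fun t => ((t - A.pw (sn n t)) * A.F₂ (gn n t) - A.pp (sn n t))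
        - ((t - A.pw (s t)) * A.F₂ (g t) - A.pp (s t))) A.law :=
      ((hsn n).integrable_utility (hgn n) hA).sub (hs.integrable_utility hg hA)
    rw [hA.leaderUtility_eq, hA.leaderUtility_eq,
      ← integral_sub ((hsn n).integrable_utility (hgn n) hA) (hs.integrable_utility hg hA),
      ← integral_sub hd hi, ← integral_div]
    refine integral_congr_ae (Eventually.of_forall fun t => ?_)
    simp only [hDdef]
    ring
  simp only [heq]
  rw [← integral_neg]
  have hpay : ∀ n, ∀ t ∈ Ioc A.a₁ A.a₂,
      (A.pw (sn n t) * A.F₁ t + A.pp (sn n t)) - (A.pw (s t) * A.F₁ t + A.pp (s t))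
      = ∫ u in Ioc A.a₁ t, gn n u ∂A.law - ∫ u in Ioc A.a₁ t, g u ∂A.law := fun n t ht => by
    rw [(hsn n).payment_eq hA ht, hs.payment_eq hA ht]
  refine tendsto_integral_filter_of_norm_le_const (Eventually.of_forall fun n => ?_)
    ⟨C * 1 + C, Eventually.of_forall fun n => ae_law_of_forall fun t ht => ?_⟩
    ?_
  · have h1 := (hsn n).aestronglyMeasurable_comp (hgn n) hA hA.differentiable_pw.continuous
    have h2 := hs.aestronglyMeasurable_comp hg hA hA.differentiable_pw.continuous
    have h3 := (hsn n).aestronglyMeasurable_comp (hgn n) hA hA.differentiable_pp.continuous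
    have h4 := hs.aestronglyMeasurable_comp hg hA hA.differentiable_pp.continuous
    simp only [hDdef, div_eq_mul_inv]
    exact ((((h1.sub h2).mul_const _).mul ((hgn n).aestronglyMeasurable_F₂ hA)).neg).sub
      ((h3.sub h4).mul_const _)
  · have hF1 := hA.F₁_pos ht
    have hs0 := (hs t ht).1
    have hn0 := (hsn n t ht).1
    have hb := hC n t ht
    rw [← hpay n t ht] at hb
    -- The factor F₁(t) in the hypothesis on C cancels the weight of pw, so the bound is uniform up
    -- to a₁.
    have h1 := (hA.abs_pw_sub_le (w := A.F₁ t) hs0 hn0).trans hb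
    have h1' : |A.pw (sn n t) - A.pw (s t)| ≤ C * m n := le_of_mul_le_mul_right h1 hF1
    have h2 := (hA.abs_pp_sub_le hs0 hn0 hF1).trans hb
    have h2' : |A.pp (sn n t) - A.pp (s t)| ≤ C * m n :=
      h2.trans (mul_le_of_le_one_right (mul_nonneg hC0 (hm n).le) (hA.F₁_le_one t))
    simp only [hDdef]
    rw [Real.norm_eq_abs]
    refine (abs_sub _ _).trans (add_le_add ?_ ?_)
    · rw [abs_neg, abs_mul, abs_div, abs_of_pos (hm n)]
      refine mul_le_mul ?_ (hA.abs_F₂_le _) (abs_nonneg _) hC0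
      rwa [div_le_iff₀ (hm n)]
    · rw [abs_div, abs_of_pos (hm n)]
      rwa [div_le_iff₀ (hm n)]
  · have hmem : ∀ᵐ t ∂A.law, t ∈ Ioo A.a₁ A.a₂ := ae_law_of_forall_Ioo fun t ht => ht
    filter_upwards [hmem, hF] with t ht hFt
    have ht' := Ioo_subset_Ioc_self ht
    have h := hΓ t ht
    simp only [← hpay _ t ht'] at h
    obtain ⟨h1, h2⟩ := hA.tendsto_payment_quotients (hA.F₁_pos ht') (hs t ht').1
      (fun n => (hsn n t ht').1) hm0 hm h
    have h3 := ((h1.mul hFt).neg).sub h2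
    refine h3.trans (le_of_eq ?_)
    congr 1
    simp only [rate]
    ring

/-- The first-order condition for optimality. -/
theorem Standing.le_of_isOptimal (hopt : A.IsOptimal g s)
    {gn : ℕ → ℝ → ℝ} (hgn : ∀ n, A.IsEqualBid (gn n))
    {m : ℕ → ℝ} (hm : ∀ n, 0 < m n) (hm0 : Tendsto m atTop (𝓝 0)) {C : ℝ}
    (hC : ∀ n, ∀ t ∈ Ioc A.a₁ A.a₂,
      |∫ u in Ioc A.a₁ t, gn n u ∂A.law - ∫ u in Ioc A.a₁ t, g u ∂A.law| ≤ C * m n * A.F₁ t)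
    {Γ : ℝ → ℝ} (hΓ : ∀ t ∈ Ioo A.a₁ A.a₂, Tendsto (fun n =>
      (∫ u in Ioc A.a₁ t, gn n u ∂A.law - ∫ u in Ioc A.a₁ t, g u ∂A.law) / m n) atTop (𝓝 (Γ t)))
    (hF : ∀ᵐ t ∂A.law, Tendsto (fun n => A.F₂ (gn n t)) atTop (𝓝 (A.F₂ (g t)))) {E : ℝ}
    (hE : Tendsto (fun n => (∫ t, (t - A.pw (s t)) * (A.F₂ (gn n t) - A.F₂ (g t)) ∂A.law) / m n)
      atTop (𝓝 E)) :
    E ≤ ∫ t, A.rate g s t * Γ t ∂A.law := by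
  choose sn hsn using fun n => (hgn n).exists_strategy hA
  have h := (hA.tendsto_utility_quotient hopt.1 hopt.2.1 hgn hsn hm hm0 hC hΓ hF).add hE
  have hle : ∀ n, (A.leaderUtility (gn n) (sn n) - A.leaderUtility g s
        - ∫ t, (t - A.pw (s t)) * (A.F₂ (gn n t) - A.F₂ (g t)) ∂A.law) / m n
      + (∫ t, (t - A.pw (s t)) * (A.F₂ (gn n t) - A.F₂ (g t)) ∂A.law) / m n ≤ 0 := by
    intro n
    rw [← add_div, sub_add_cancel]
    exact div_nonpos_of_nonpos_of_nonneg
      (sub_nonpos.2 (hopt.2.2 _ _ (hgn n) (hsn n))) (hm n).le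
  have := le_of_tendsto h (Eventually.of_forall hle)
  linarith

end Expansion

/-- Changing an equal-bid function to a constant on a subinterval. -/
theorem IsEqualBid.modify {g : ℝ → ℝ} (hg : A.IsEqualBid g) {u v c : ℝ}
    (hc : c ∈ Icc 0 A.b₂) (hu : ∀ t ∈ Ioc A.a₁ A.a₂, t ≤ u → g t ≤ c)
    (hv : ∀ t ∈ Ioc A.a₁ A.a₂, v < t → c ≤ g t) :
    A.IsEqualBid (fun t => if t ∈ Ioc u v then c else g t) where
  mem_Icc x hx := by
    split_ifs
    exacts [hc, hg.mem_Icc x hx]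
  monotoneOn x hx y hy hxy := by
    dsimp only
    split_ifs with h1 h2 h2
    · exact le_rfl
    · exact hv y hy (by by_contra h; exact h2 ⟨h1.1.trans_le hxy, not_lt.1 h⟩)
    · exact hu x hx (by by_contra h; exact h1 ⟨not_le.1 h, hxy.trans h2.2⟩)
    · exact hg.monotoneOn hx hy hxy
  leftContinuous x hx := by
    by_cases h : x ∈ Ioc u v
    · refine (continuousWithinAt_const (b := c)).congr_of_eventuallyEq ?_ (by simp [h])
      filter_upwards [Ioc_mem_nhdsLE h.1] with t ht
      simp only [mem_Ioc]
      rw [if_pos ⟨ht.1, ht.2.trans h.2⟩]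
    · refine (hg.leftContinuous x hx).congr_of_eventuallyEq ?_ (by simp [h])
      rcases le_or_gt x u with h1 | h1
      · filter_upwards [self_mem_nhdsWithin] with t ht
        rw [if_neg fun h' => absurd (h'.1.trans_le ht) (not_lt.2 h1)]
      · have h2 : v < x := by by_contra h'; exact h ⟨h1, not_lt.1 h'⟩
        filter_upwards [Ioc_mem_nhdsLE h2] with t ht
        rw [if_neg fun h' => absurd ht.1 (not_lt.2 h'.2)]

end RankBidAuction

/-! ### Needle variations. -/

namespace RankBidAuction

variable {A : RankBidAuction} {g s : ℝ → ℝ}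

/-- One-sided continuity at x gives convergence of the averages at the given point x, not merely at
almost every point. -/
theorem Standing.tendsto_average_Ioc (hA : A.Standing) {φ : ℝ → ℝ} (hφ : Integrable φ A.law)
    {x : ℝ} (hx : x ≤ A.a₂) (hc : ContinuousWithinAt φ (Iic x) x) {y : ℕ → ℝ}
    (hy : ∀ n, y n < x) (hy1 : ∀ n, A.a₁ ≤ y n) (hyx : Tendsto y atTop (𝓝 x)) :
    Tendsto (fun n => (∫ t in Ioc (y n) x, φ t ∂A.law) / A.law.real (Ioc (y n) x)) atTop
      (𝓝 (φ x)) := by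
  have hfin := hA.isFiniteMeasure_law
  rw [Metric.tendsto_nhds]
  intro ε hε
  have h1 := Metric.continuousWithinAt_iff.1 hc (ε / 2) (half_pos hε)
  obtain ⟨δ, hδ, h1⟩ := h1
  filter_upwards [hyx.eventually (lt_mem_nhds (sub_lt_self x hδ))] with n hn
  have hpos := hA.law_real_Ioc_pos (hy1 n) (hy n) hx
  have h2 : ‖∫ t in Ioc (y n) x, (φ t - φ x) ∂A.law‖ ≤ ε / 2 * A.law.real (Ioc (y n) x) := by
    refine norm_setIntegral_le_of_norm_le_const (measure_lt_top _ _) fun t ht => ?_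
    rw [← dist_eq_norm]
    refine (h1 ht.2 ?_).le
    rw [Real.dist_eq, abs_lt]
    constructor <;> linarith [ht.1, ht.2]
  rw [integral_sub hφ.integrableOn (integrable_const _), setIntegral_const, smul_eq_mul] at h2
  rw [Real.dist_eq]
  have h3 : (∫ t in Ioc (y n) x, φ t ∂A.law) / A.law.real (Ioc (y n) x) - φ x
      = ((∫ t in Ioc (y n) x, φ t ∂A.law) - A.law.real (Ioc (y n) x) * φ x)
        / A.law.real (Ioc (y n) x) := by
    field_simp
  rw [h3, abs_div, abs_of_pos hpos, div_lt_iff₀ hpos]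
  refine lt_of_le_of_lt h2 ?_
  have := mul_pos hε hpos
  linarith

theorem IsEqualBid.abs_sub_le {g g' : ℝ → ℝ} (hg : A.IsEqualBid g) (hg' : A.IsEqualBid g')
    {t : ℝ} (ht : t ∈ Ioc A.a₁ A.a₂) : |g' t - g t| ≤ A.b₂ := by
  have h1 := hg.mem_Icc t ht
  have h2 := hg'.mem_Icc t ht
  rw [abs_le]
  constructor <;> linarith [h1.1, h1.2, h2.1, h2.2]

/-- Raising the equal bids of the types just below `x` does not pay. -/
theorem IsOptimal.needle (hopt : A.IsOptimal g s) (hA : A.Standing) {x γ : ℝ}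
    (hx : x ∈ Ioc A.a₁ A.a₂) (hγ : γ ∈ Icc (g x) A.b₂)
    (hγt : ∀ t ∈ Ioc A.a₁ A.a₂, x < t → γ ≤ g t) :
    (x - A.pw (s x)) * (A.F₂ γ - A.F₂ (g x)) ≤ (γ - g x) * A.tailLoss g s x := by
  have hfin := hA.isFiniteMeasure_law
  have hg := hopt.1
  have hs := hopt.2.1
  set y : ℕ → ℝ := fun n => x - (x - A.a₁) / ((n : ℝ) + 2) with hy
  have hxa : 0 < x - A.a₁ := sub_pos.2 hx.1
  have hyx : ∀ n, y n < x := fun n => sub_lt_self _ (by positivity)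
  have hyt : Tendsto y atTop (𝓝 x) := by
    have h1 : Tendsto (fun n : ℕ => (x - A.a₁) / ((n : ℝ) + 2)) atTop (𝓝 0) :=
      tendsto_const_nhds.div_atTop
        (tendsto_atTop_add_const_right _ _ tendsto_natCast_atTop_atTop)
    simpa using h1.const_sub x
  -- All needles lie to the right of the midpoint z, so F₁ is at least F₁(z) > 0 wherever the
  -- payment changes.
  set z : ℝ := x - (x - A.a₁) / 2 with hz
  have hza : A.a₁ < z := by rw [hz]; linarith
  have hyz : ∀ n, z ≤ y n := by
    intro n
    have h2 : (x - A.a₁) / ((n : ℝ) + 2) ≤ (x - A.a₁) / 2 :=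
      div_le_div_of_nonneg_left hxa.le two_pos (by linarith [n.cast_nonneg (α := ℝ)])
    simp only [hy, hz]
    linarith
  have hya : ∀ n, A.a₁ ≤ y n := fun n => hza.le.trans (hyz n)
  have hzx : z ≤ x := (hyz 0).trans (hyx 0).le
  have hzm : z ∈ Ioc A.a₁ A.a₂ := ⟨hza, hzx.trans hx.2⟩
  have hb2 : γ ∈ Icc 0 A.b₂ := ⟨(hg.mem_Icc x hx).1.trans hγ.1, hγ.2⟩
  set gn : ℕ → ℝ → ℝ := fun n t => if t ∈ Ioc (y n) x then γ else g t with hgn_def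
  have hgn : ∀ n, A.IsEqualBid (gn n) := fun n =>
    hg.modify hb2 (fun t ht htu => (hg.monotoneOn ht hx (htu.trans (hyx n).le)).trans hγ.1) hγt
  have hgi := hg.integrable hA
  have hpos : ∀ n, 0 < A.law.real (Ioc (y n) x) := fun n =>
    hA.law_real_Ioc_pos (hya n) (hyx n) hx.2
  have hm0 : Tendsto (fun n => A.law.real (Ioc (y n) x)) atTop (𝓝 0) := by
    have h1 := (hA.continuous_setIntegral_law (integrable_const (1 : ℝ)))
    have h2 : ∀ n, A.law.real (Ioc (y n) x)
        = ∫ t in Ioc A.a₁ x, (1 : ℝ) ∂A.law - ∫ t in Ioc A.a₁ (y n), (1 : ℝ) ∂A.law := by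
      intro n
      have h3 : Ioc (y n) x = Ioc A.a₁ x \ Ioc A.a₁ (y n) := by
        ext t; simp only [Set.mem_sdiff, mem_Ioc]; have := hya n; grind
      rw [h3, measureReal_sdiff (Ioc_subset_Ioc_right (hyx n).le) measurableSet_Ioc]
      simp
    simp only [h2]
    simpa using ((h1.tendsto x).comp hyt).const_sub (∫ t in Ioc A.a₁ x, (1 : ℝ) ∂A.law)
  have hdiff : ∀ n t, ∫ u in Ioc A.a₁ t, gn n u ∂A.law - ∫ u in Ioc A.a₁ t, g u ∂A.law
      = ∫ u in Ioc A.a₁ t ∩ Ioc (y n) x, (γ - g u) ∂A.law := by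
    intro n t
    rw [← integral_sub ((hgn n).integrable hA).integrableOn hgi.integrableOn,
      ← setIntegral_indicator measurableSet_Ioc]
    refine integral_congr_ae (Eventually.of_forall fun u => ?_)
    by_cases hu : u ∈ Ioc (y n) x
    · simp only [hgn_def, if_pos hu, indicator_of_mem hu]
    · simp only [hgn_def, if_neg hu, indicator_of_notMem hu, sub_self]
  have hφ : Integrable (fun u => γ - g u) A.law := (integrable_const _).sub hgi
  have hneg : (x - A.pw (s x)) * (A.F₂ γ - A.F₂ (g x)) ≤
      ∫ t, A.rate g s t * (if t < x then 0 else γ - g x) ∂A.law := by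
    -- Per unit of needle mass the payment changes by 0 below x and, in the limit, by γ - g(x) from
    -- x on. The winning probability is eventually unchanged at every t ≠ x.
    refine hA.le_of_isOptimal hopt hgn hpos hm0 (C := A.b₂ / A.F₁ z) ?_ ?_ ?_ ?_
    · intro n t ht
      rw [hdiff]
      have hz0 := hA.F₁_pos hzm
      have hb0 : 0 ≤ A.b₂ := hb2.1.trans hb2.2
      rcases le_or_gt t (y n) with hty | hty
      · have : Ioc A.a₁ t ∩ Ioc (y n) x = ∅ := by
          ext u; simp only [mem_inter_iff, mem_Ioc, mem_empty_iff_false, iff_false]; grind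
        rw [this, setIntegral_empty, abs_zero]
        have := (hA.F₁_pos ht).le
        have := (hpos n).le
        positivity
      · have h1 : ‖∫ u in Ioc A.a₁ t ∩ Ioc (y n) x, (γ - g u) ∂A.law‖
            ≤ A.b₂ * A.law.real (Ioc A.a₁ t ∩ Ioc (y n) x) := by
          refine norm_setIntegral_le_of_norm_le_const (measure_lt_top _ _) fun u hu => ?_
          have hu' : u ∈ Ioc A.a₁ A.a₂ := ⟨hu.1.1, hu.1.2.trans ht.2⟩
          have := hg.abs_sub_le (hgn n) hu'
          simpa only [hgn_def, if_pos hu.2, Real.norm_eq_abs] using this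
        rw [← Real.norm_eq_abs]
        refine h1.trans ?_
        have h2 : A.law.real (Ioc A.a₁ t ∩ Ioc (y n) x) ≤ A.law.real (Ioc (y n) x) :=
          measureReal_mono inter_subset_right
        have h3 : A.F₁ z ≤ A.F₁ t := hA.F₁_mono ((hyz n).trans hty.le)
        calc A.b₂ * A.law.real (Ioc A.a₁ t ∩ Ioc (y n) x)
            ≤ A.b₂ * A.law.real (Ioc (y n) x) := mul_le_mul_of_nonneg_left h2 hb0
          _ = A.b₂ / A.F₁ z * A.law.real (Ioc (y n) x) * A.F₁ z := by field_simp
          _ ≤ _ := by gcongr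
    · intro t ht
      simp only [hdiff]
      split_ifs with htx
      · refine tendsto_const_nhds.congr' ?_
        filter_upwards [hyt.eventually (lt_mem_nhds htx)] with n hn
        have : Ioc A.a₁ t ∩ Ioc (y n) x = ∅ := by
          ext u; simp only [mem_inter_iff, mem_Ioc, mem_empty_iff_false, iff_false]; grind
        rw [this, setIntegral_empty, zero_div]
      · refine (hA.tendsto_average_Ioc hφ hx.2
          (continuousWithinAt_const.sub (hg.leftContinuous x hx)) hyx hya hyt).congr fun n => ?_
        rw [inter_eq_right.2 (Ioc_subset_Ioc (hya n) (not_lt.1 htx))]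
    · have hne : ∀ᵐ t ∂A.law, t ≠ x := by simp [ae_iff]
      filter_upwards [hne] with t ht
      refine tendsto_const_nhds.congr' ?_
      rcases lt_or_gt_of_ne ht with h | h
      · filter_upwards [hyt.eventually (lt_mem_nhds h)] with n hn
        simp only [hgn_def]
        rw [if_neg fun h' => absurd h'.1 (not_lt.2 hn.le)]
      · filter_upwards with n
        simp only [hgn_def]
        rw [if_neg fun h' => absurd h'.2 (not_le.2 h)]
    · have hψm : AEStronglyMeasurable (fun t => (t - A.pw (s t)) * (A.F₂ γ - A.F₂ (g t))) A.law :=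
        (hs.aestronglyMeasurable_margin hg hA).mul
          (aestronglyMeasurable_const.sub (hg.aestronglyMeasurable_F₂ hA))
      obtain ⟨K, hK0, hK⟩ := hA.exists_payment_bound
      have hψ : Integrable (fun t => (t - A.pw (s t)) * (A.F₂ γ - A.F₂ (g t))) A.law := by
        refine hA.integrable_law hψm (K * (1 + 1)) fun t ht => ?_
        rw [abs_mul]
        refine mul_le_mul (hK g s hg hs t ht).2.2.2 ?_ (abs_nonneg _) hK0
        exact (abs_sub _ _).trans (add_le_add (hA.abs_F₂_le _) (hA.abs_F₂_le _))
      have hsc : ContinuousWithinAt s (Iic x) x :=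
        (hs.continuousOn hg hA x hx).mono_of_mem_nhdsWithin
          (by filter_upwards [Ioc_mem_nhdsLE hx.1] with t ht using ⟨ht.1, ht.2.trans hx.2⟩)
      have hψc : ContinuousWithinAt (fun t => (t - A.pw (s t)) * (A.F₂ γ - A.F₂ (g t)))
          (Iic x) x :=
        (continuousWithinAt_id.sub
          (hA.differentiable_pw.continuous.continuousAt.comp_continuousWithinAt hsc)).mul
          (continuousWithinAt_const.sub
            (hA.continuous_F₂.continuousAt.comp_continuousWithinAt (hg.leftContinuous x hx)))
      refine (hA.tendsto_average_Ioc hψ hx.2 hψc hyx hya hyt).congr fun n => ?_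
      congr 1
      rw [← integral_indicator measurableSet_Ioc]
      refine integral_congr_ae (Eventually.of_forall fun u => ?_)
      by_cases hu : u ∈ Ioc (y n) x
      · simp only [hgn_def, if_pos hu, indicator_of_mem hu]
      · simp only [hgn_def, if_neg hu, indicator_of_notMem hu, sub_self, mul_zero]
  refine hneg.trans (le_of_eq ?_)
  rw [tailLoss, ← integral_const_mul, ← integral_indicator measurableSet_Ioc]
  have hne : ∀ᵐ t ∂A.law, t ≠ x := by simp [ae_iff]
  have hmem : ∀ᵐ t ∂A.law, t ∈ Ioc A.a₁ A.a₂ := ae_law_of_forall fun t ht => ht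
  refine integral_congr_ae ?_
  filter_upwards [hne, hmem] with t ht htm
  rcases lt_or_gt_of_ne ht with h | h
  · rw [indicator_of_notMem fun h' => absurd h'.1 (not_lt.2 h.le)]
    simp [h]
  · rw [indicator_of_mem (show t ∈ Ioc x A.a₂ from ⟨h, htm.2⟩), if_neg (not_lt.2 h.le), mul_comm]

/-- A type whose marginal utility of a higher equal bid is positive pools with the types
just above. -/
theorem IsOptimal.not_raisable (hopt : A.IsOptimal g s) (hA : A.Standing) {x γ : ℝ}
    (hx : x ∈ Ioc A.a₁ A.a₂) (hk : 0 < (x - A.pw (s x)) * A.f₂ (g x) - A.tailLoss g s x)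
    (hγb : γ ≤ A.b₂) (hγt : ∀ t ∈ Ioc A.a₁ A.a₂, x < t → γ ≤ g t) : γ ≤ g x := by
  by_contra! hlt
  have hd := ((hA.hasDerivWithinAt_F₂_Ici (hlt.trans_le hγb)).mono
    (Ioi_subset_Ici_self))
  rw [hasDerivWithinAt_iff_tendsto_slope' self_notMem_Ioi] at hd
  have h1 := (hd.const_mul (x - A.pw (s x))).sub_const (A.tailLoss g s x)
  -- The needle inequality for γ = y, divided by y - g(x), contradicts `hk` as y decreases to g(x).
  refine absurd (le_of_tendsto h1 ?_) (not_le.2 hk)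
  filter_upwards [Ioc_mem_nhdsGT hlt] with y hy
  have h2 := hopt.needle hA hx (γ := y) ⟨hy.1.le, hy.2.trans hγb⟩
    fun t ht hxt => hy.2.trans (hγt t ht hxt)
  have h3 : 0 < y - g x := sub_pos.2 hy.1
  rw [slope_def_field, sub_nonpos, ← mul_div_assoc, div_le_iff₀ h3]
  linarith

end RankBidAuction

/-! ### Directional derivatives along convex combinations. -/

namespace RankBidAuction

variable {A : RankBidAuction} {g g' s : ℝ → ℝ}

theorem IsEqualBid.lineMap (hg : A.IsEqualBid g) (hg' : A.IsEqualBid g') {c : ℝ} (h0 : 0 ≤ c)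
    (h1 : c ≤ 1) : A.IsEqualBid (fun t => g t + c * (g' t - g t)) where
  mem_Icc x hx := by
    have h2 := hg.mem_Icc x hx
    have h3 := hg'.mem_Icc x hx
    constructor <;> nlinarith [h2.1, h2.2, h3.1, h3.2]
  monotoneOn x hx y hy hxy := by
    have h2 := hg.monotoneOn hx hy hxy
    have h3 := hg'.monotoneOn hx hy hxy
    dsimp only
    nlinarith
  leftContinuous x hx :=
    (hg.leftContinuous x hx).add
      (continuousWithinAt_const.mul ((hg'.leftContinuous x hx).sub (hg.leftContinuous x hx)))

/-- Interchange of the order of integration between the types that raise their equal bid and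
the types that pay for it. -/
theorem IsStrategyOf.integral_rate_mul (hs : A.IsStrategyOf g s) (hg : A.IsEqualBid g)
    (hA : A.Standing) {η : ℝ → ℝ} (hη : AEStronglyMeasurable η A.law) {B : ℝ} (hB0 : 0 ≤ B)
    (hB : ∀ t ∈ Ioc A.a₁ A.a₂, |η t| ≤ B) :
    Integrable (fun u => η u * A.tailLoss g s u) A.law ∧
      ∫ t, A.rate g s t * ∫ u in Ioc A.a₁ t, η u ∂A.law ∂A.law
        = ∫ u, η u * A.tailLoss g s u ∂A.law := by
  have hfin := hA.isFiniteMeasure_law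
  set S : Set (ℝ × ℝ) := {p | p.2 < p.1} with hS
  have hSm : MeasurableSet S := measurableSet_lt measurable_snd measurable_fst
  set f : ℝ → ℝ → ℝ := fun t u => S.indicator (fun p => A.rate g s p.1 * η p.2) (t, u) with hf
  have hηi : Integrable η A.law := hA.integrable_law hη B hB
  have hmem : ∀ᵐ t ∂A.law, t ∈ Ioc A.a₁ A.a₂ := ae_law_of_forall fun t ht => ht
  have hsec : ∀ t, ∀ᵐ u ∂A.law, f t u
      = (Ioc A.a₁ t).indicator (fun u => A.rate g s t * η u) u := by
    intro t
    have hne : ∀ᵐ u ∂A.law, u ≠ t := by simp [ae_iff]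
    filter_upwards [hmem, hne] with u hu hut
    simp only [hf, hS]
    rcases lt_or_gt_of_ne hut with h | h
    · rw [indicator_of_mem (show (t, u) ∈ {p : ℝ × ℝ | p.2 < p.1} from h),
        indicator_of_mem (show u ∈ Ioc A.a₁ t from ⟨hu.1, h.le⟩)]
    · rw [indicator_of_notMem (show (t, u) ∉ {p : ℝ × ℝ | p.2 < p.1} from not_lt.2 h.le),
        indicator_of_notMem fun h' => absurd h'.2 (not_le.2 h)]
  have hsec' : ∀ u, ∀ᵐ t ∂A.law, f t u
      = (Ioc u A.a₂).indicator (fun t => η u * A.rate g s t) t := by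
    intro u
    filter_upwards [hmem] with t ht
    simp only [hf, hS]
    by_cases h : u < t
    · rw [indicator_of_mem (show (t, u) ∈ {p : ℝ × ℝ | p.2 < p.1} from h),
        indicator_of_mem (show t ∈ Ioc u A.a₂ from ⟨h, ht.2⟩), mul_comm]
    · rw [indicator_of_notMem (show (t, u) ∉ {p : ℝ × ℝ | p.2 < p.1} from h),
        indicator_of_notMem fun h' => h h'.1]
  have hfm : AEStronglyMeasurable (Function.uncurry f) (A.law.prod A.law) :=
    (((hs.aestronglyMeasurable_rate hg hA).comp_fst).mul hη.comp_snd).indicator hSm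
  -- Integrability on the product: the inner integral of |η| over (a₁, t] is at most B F₁(t), and
  -- `rate` · F₁ ≤ 1.
  have hint : Integrable (Function.uncurry f) (A.law.prod A.law) := by
    refine (integrable_prod_iff hfm).2 ⟨Eventually.of_forall fun t => ?_, ?_⟩
    · exact ((hηi.const_mul _).indicator measurableSet_Ioc).congr
        ((hsec t).mono fun u hu => hu.symm)
    · refine hA.integrable_law hfm.norm.integral_prod_right' B fun t ht => ?_
      rw [abs_of_nonneg (integral_nonneg fun u => norm_nonneg _)]
      have h1 : ∫ u, ‖Function.uncurry f (t, u)‖ ∂A.law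
          = ∫ u in Ioc A.a₁ t, ‖A.rate g s t * η u‖ ∂A.law := by
        rw [← integral_indicator measurableSet_Ioc]
        refine integral_congr_ae ((hsec t).mono fun u hu => ?_)
        simp only [Function.uncurry_apply_pair]
        rw [hu, norm_indicator_eq_indicator_norm]
      have hr := hs.rate_nonneg hA ht
      have h2 : ∫ u in Ioc A.a₁ t, ‖A.rate g s t * η u‖ ∂A.law
          ≤ ∫ u in Ioc A.a₁ t, A.rate g s t * B ∂A.law := by
        refine integral_mono_ae ((hηi.const_mul _).norm.integrableOn) (integrable_const _)
          (ae_restrict_of_ae (hmem.mono fun u hu => ?_))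
        simp only [norm_mul, Real.norm_eq_abs]
        rw [abs_of_nonneg hr]
        exact mul_le_mul_of_nonneg_left (hB u hu) hr
      rw [h1]
      refine h2.trans ?_
      rw [setIntegral_const, ← hA.F₁_eq_law ht.1.le ht.2, smul_eq_mul]
      have := mul_le_mul_of_nonneg_right (hs.rate_mul_F₁_le hA ht) hB0
      linarith
  have hinner : ∀ u, ∫ t, f t u ∂A.law = η u * A.tailLoss g s u := by
    intro u
    rw [integral_congr_ae (hsec' u), integral_indicator measurableSet_Ioc, integral_const_mul,
      tailLoss]
  constructor
  · refine hint.integral_prod_right.congr (Eventually.of_forall fun u => ?_)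
    exact hinner u
  · rw [← integral_congr_ae (Eventually.of_forall hinner), ← integral_integral_swap hint]
    refine integral_congr_ae (Eventually.of_forall fun t => ?_)
    simp only
    rw [integral_congr_ae (hsec t), integral_indicator measurableSet_Ioc, integral_const_mul]

/-- The directional derivative of the utility is nonpositive at an optimum. -/
theorem IsOptimal.directional (hopt : A.IsOptimal g s) (hA : A.Standing)
    (hg' : A.IsEqualBid g') {d : ℝ → ℝ}
    (hd : ∀ t ∈ Ioo A.a₁ A.a₂, Tendsto (fun n : ℕ =>
      (A.F₂ (g t + 1 / ((n : ℝ) + 1) * (g' t - g t)) - A.F₂ (g t)) / (1 / ((n : ℝ) + 1)))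
      atTop (𝓝 (d t))) :
    Integrable (fun t => (t - A.pw (s t)) * d t - (g' t - g t) * A.tailLoss g s t) A.law ∧
      ∫ t, ((t - A.pw (s t)) * d t - (g' t - g t) * A.tailLoss g s t) ∂A.law ≤ 0 := by
  have hfin := hA.isFiniteMeasure_law
  have hg := hopt.1
  have hs := hopt.2.1
  obtain ⟨K, hK0, hK⟩ := hA.exists_payment_bound
  obtain ⟨M, hM0, hM⟩ := hA.exists_F₂_lipschitz
  have hb0 : 0 ≤ A.b₂ := hA.b₁_nonneg.trans hA.b₁_lt_b₂.le
  set c : ℕ → ℝ := fun n => 1 / ((n : ℝ) + 1) with hc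
  have hcpos : ∀ n, 0 < c n := fun n => Nat.one_div_pos_of_nat
  have hc1 : ∀ n, c n ≤ 1 := fun n => by
    rw [hc, div_le_one (by positivity)]
    linarith [n.cast_nonneg (α := ℝ)]
  have hc0 : Tendsto c atTop (𝓝 0) := tendsto_one_div_add_atTop_nhds_zero_nat
  set gn : ℕ → ℝ → ℝ := fun n t => g t + c n * (g' t - g t) with hgn_def
  have hgn : ∀ n, A.IsEqualBid (gn n) := fun n => hg.lineMap hg' (hcpos n).le (hc1 n)
  have hgi := hg.integrable hA
  have hgi' := hg'.integrable hA
  have hη : ∀ t ∈ Ioc A.a₁ A.a₂, |g' t - g t| ≤ A.b₂ := fun t ht => hg.abs_sub_le hg' ht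
  have hquot : ∀ n, ∀ t ∈ Ioc A.a₁ A.a₂,
      |(A.F₂ (gn n t) - A.F₂ (g t)) / c n| ≤ M * A.b₂ := by
    intro n t ht
    rw [abs_div, abs_of_pos (hcpos n), div_le_iff₀ (hcpos n)]
    refine (hM _ _).trans ?_
    simp only [hgn_def]
    rw [add_sub_cancel_left, abs_mul, abs_of_pos (hcpos n)]
    have := mul_le_mul_of_nonneg_left (hη t ht) (mul_nonneg hM0 (hcpos n).le)
    linarith
  have hmeas : ∀ n, AEStronglyMeasurable
      (fun t => (t - A.pw (s t)) * ((A.F₂ (gn n t) - A.F₂ (g t)) / c n)) A.law := by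
    intro n
    simp only [div_eq_mul_inv]
    exact (hs.aestronglyMeasurable_margin hg hA).mul
      ((((hgn n).aestronglyMeasurable_F₂ hA).sub (hg.aestronglyMeasurable_F₂ hA)).mul_const _)
  have hbound : ∀ n, ∀ t ∈ Ioc A.a₁ A.a₂,
      |(t - A.pw (s t)) * ((A.F₂ (gn n t) - A.F₂ (g t)) / c n)| ≤ K * (M * A.b₂) := by
    intro n t ht
    rw [abs_mul]
    exact mul_le_mul (hK g s hg hs t ht).2.2.2 (hquot n t ht) (abs_nonneg _) hK0
  have hlim : ∀ t ∈ Ioo A.a₁ A.a₂, Tendsto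
      (fun n => (t - A.pw (s t)) * ((A.F₂ (gn n t) - A.F₂ (g t)) / c n)) atTop
      (𝓝 ((t - A.pw (s t)) * d t)) := fun t ht => (hd t ht).const_mul _
  have hE : Tendsto (fun n =>
      (∫ t, (t - A.pw (s t)) * (A.F₂ (gn n t) - A.F₂ (g t)) ∂A.law) / c n) atTop
      (𝓝 (∫ t, (t - A.pw (s t)) * d t ∂A.law)) := by
    refine (tendsto_integral_filter_of_norm_le_const (Eventually.of_forall hmeas)
      ⟨K * (M * A.b₂), Eventually.of_forall fun n => ae_law_of_forall (hbound n)⟩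
      (ae_law_of_forall_Ioo hlim)).congr fun n => ?_
    rw [← integral_div]
    refine integral_congr_ae (Eventually.of_forall fun t => ?_)
    simp only
    ring
  have hdi : Integrable (fun t => (t - A.pw (s t)) * d t) A.law := by
    refine Integrable.of_bound (aestronglyMeasurable_of_tendsto_ae atTop hmeas
      (ae_law_of_forall_Ioo hlim)) (K * (M * A.b₂)) (ae_law_of_forall_Ioo fun t ht => ?_)
    exact le_of_tendsto (hlim t ht).norm
      (Eventually.of_forall fun n => hbound n t (Ioo_subset_Ioc_self ht))
  have hdiff : ∀ n t, ∫ u in Ioc A.a₁ t, gn n u ∂A.law - ∫ u in Ioc A.a₁ t, g u ∂A.law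
      = c n * ∫ u in Ioc A.a₁ t, (g' u - g u) ∂A.law := by
    intro n t
    rw [← integral_sub ((hgn n).integrable hA).integrableOn hgi.integrableOn,
      ← integral_const_mul]
    refine integral_congr_ae (Eventually.of_forall fun u => ?_)
    simp only [hgn_def]
    ring
  have hfub := hs.integral_rate_mul hg hA (hgi'.sub hgi).aestronglyMeasurable hb0 hη
  have key : ∫ t, (t - A.pw (s t)) * d t ∂A.law ≤
      ∫ t, A.rate g s t * ∫ u in Ioc A.a₁ t, (g' u - g u) ∂A.law ∂A.law := by
    refine hA.le_of_isOptimal hopt hgn hcpos hc0 (C := A.b₂) ?_ ?_ ?_ hE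
    · intro n t ht
      rw [hdiff, abs_mul, abs_of_pos (hcpos n), hA.F₁_eq_law ht.1.le ht.2]
      have h1 : ‖∫ u in Ioc A.a₁ t, (g' u - g u) ∂A.law‖ ≤ A.b₂ * A.law.real (Ioc A.a₁ t) :=
        norm_setIntegral_le_of_norm_le_const (measure_lt_top _ _) fun u hu =>
          hη u ⟨hu.1, hu.2.trans ht.2⟩
      have := mul_le_mul_of_nonneg_left h1 (hcpos n).le
      rw [Real.norm_eq_abs] at this
      linarith
    · intro t ht
      refine tendsto_const_nhds.congr fun n => ?_
      rw [hdiff, mul_div_cancel_left₀ _ (hcpos n).ne']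
    · refine Eventually.of_forall fun t => ?_
      refine (hA.continuous_F₂.tendsto _).comp ?_
      simpa [hgn_def] using (hc0.mul_const (g' t - g t)).const_add (g t)
  refine ⟨hdi.sub hfub.1, ?_⟩
  have h2 := hfub.2
  simp only [Pi.sub_apply] at h2
  have h1 := integral_sub hdi hfub.1
  simp only [Pi.sub_apply] at h1
  rw [h1, ← h2]
  exact sub_nonpos.2 key

/-- If the directional derivative has a nonnegative integrand, then the integrand has a zero in
every interval. -/
theorem IsOptimal.not_forall_pos (hopt : A.IsOptimal g s) (hA : A.Standing)
    (hg' : A.IsEqualBid g') {d : ℝ → ℝ}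
    (hd : ∀ t ∈ Ioo A.a₁ A.a₂, Tendsto (fun n : ℕ =>
      (A.F₂ (g t + 1 / ((n : ℝ) + 1) * (g' t - g t)) - A.F₂ (g t)) / (1 / ((n : ℝ) + 1)))
      atTop (𝓝 (d t)))
    (hnonneg : ∀ᵐ t ∂A.law,
      0 ≤ (t - A.pw (s t)) * d t - (g' t - g t) * A.tailLoss g s t)
    {u v : ℝ} (hu : A.a₁ ≤ u) (huv : u < v) (hv : v ≤ A.a₂) :
    ∃ t ∈ Ioo u v, (t - A.pw (s t)) * d t - (g' t - g t) * A.tailLoss g s t = 0 := by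
  obtain ⟨hi, hle⟩ := hopt.directional hA hg' hd
  -- The integral is both nonpositive and nonnegative, so the integrand vanishes almost everywhere,
  -- while every interval has positive mass.
  have h0 := (integral_eq_zero_iff_of_nonneg_ae hnonneg hi).1
    (le_antisymm hle (integral_nonneg_of_ae hnonneg))
  by_contra! hne
  have hfin := hA.isFiniteMeasure_law
  have hpos := hA.law_real_Ioc_pos hu huv hv
  have hzero : A.law (Ioo u v) = 0 := by
    refine measure_mono_null (fun t ht => ?_) (ae_iff.1 h0)
    simpa using hne t ht
  have hzero' : A.law (Ioc u v) = 0 := by rw [← measure_congr Ioo_ae_eq_Ioc]; exact hzero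
  rw [measureReal_def, hzero'] at hpos
  simp at hpos

end RankBidAuction

/-! ### Positivity of the optimal utility and of the tail loss. -/

namespace RankBidAuction

variable {A : RankBidAuction} {g s : ℝ → ℝ}

theorem Standing.b₂_nonneg (hA : A.Standing) : 0 ≤ A.b₂ := hA.b₁_nonneg.trans hA.b₁_lt_b₂.le

theorem Standing.isEqualBid_zero (hA : A.Standing) : A.IsEqualBid (fun _ => 0) where
  mem_Icc _ _ := ⟨le_rfl, hA.b₂_nonneg⟩
  monotoneOn := monotoneOn_const
  leftContinuous _ _ := continuousWithinAt_const

theorem Standing.F₁_a₂ (hA : A.Standing) : A.F₁ A.a₂ = 1 := by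
  have hfin := hA.isFiniteMeasure_law
  rw [hA.F₁_eq_law hA.a₁_lt_a₂.le le_rfl, ← hA.law_univ]
  refine measureReal_congr ?_
  have hmem : ∀ᵐ t ∂A.law, t ∈ Ioc A.a₁ A.a₂ := ae_law_of_forall fun t ht => ht
  filter_upwards [hmem] with t ht
  exact propext ⟨fun _ => mem_univ t, fun _ => ht⟩

theorem Standing.law_real_Ioc_a₂ (hA : A.Standing) {y : ℝ} (hy : y ∈ Icc A.a₁ A.a₂) :
    A.law.real (Ioc y A.a₂) = 1 - A.F₁ y := by
  have hfin := hA.isFiniteMeasure_law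
  have h : Ioc y A.a₂ = Ioc A.a₁ A.a₂ \ Ioc A.a₁ y := by
    ext t; simp only [Set.mem_sdiff, mem_Ioc]; have := hy.1; grind
  rw [h, measureReal_sdiff (Ioc_subset_Ioc_right hy.2) measurableSet_Ioc,
    ← hA.F₁_eq_law hy.1 hy.2, ← hA.F₁_eq_law hA.a₁_lt_a₂.le le_rfl, hA.F₁_a₂]

/-- A function that is nonnegative on `(a₁, a₂)` and positive near `a₂` has positive integral. -/
theorem Standing.integral_law_pos (hA : A.Standing) {φ : ℝ → ℝ} (hi : Integrable φ A.law)
    (h0 : ∀ᵐ t ∂A.law, 0 ≤ φ t) {y : ℝ} (hy : y ∈ Ico A.a₁ A.a₂)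
    (hpos : ∀ t ∈ Ioo y A.a₂, 0 < φ t) : 0 < ∫ t, φ t ∂A.law := by
  have hfin := hA.isFiniteMeasure_law
  rw [integral_pos_iff_support_of_nonneg_ae h0 hi]
  have h1 := hA.law_real_Ioc_pos hy.1 hy.2 le_rfl
  rw [measureReal_def, measure_congr Ioo_ae_eq_Ioc.symm] at h1
  exact (ENNReal.toReal_pos_iff.1 h1).1.trans_le
    (measure_mono fun t ht => (hpos t ht).ne')

/-- The leader can obtain a positive utility by conceding almost always. -/
theorem Standing.exists_utility_pos (hA : A.Standing) :
    ∃ g s, A.IsEqualBid g ∧ A.IsStrategyOf g s ∧ 0 < A.leaderUtility g s := by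
  have hfin := hA.isFiniteMeasure_law
  have hb0 := hA.b₂_nonneg
  have ha : 0 < A.a₂ := hA.a₁_nonneg.trans_lt hA.a₁_lt_a₂
  -- Conceding b₂ on (y, a₂] costs at most b₂(1 - F₁(y)) in expectation, so F₁(y) times the utility
  -- of a type above y is at least y F₁(y) - b₂(1 - F₁(y)); the factor 2 is slack. The expression
  -- tends to a₂ > 0 as y tends to a₂.
  obtain ⟨y, hy, hψ⟩ : ∃ y ∈ Ioo A.a₁ A.a₂, 0 < y * A.F₁ y - 2 * A.b₂ * (1 - A.F₁ y) := by
    have hc : ContinuousOn (fun y => y * A.F₁ y - 2 * A.b₂ * (1 - A.F₁ y)) (Icc A.a₁ A.a₂) :=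
      (continuousOn_id.mul hA.continuousOn_F₁).sub
        (continuousOn_const.mul (continuousOn_const.sub hA.continuousOn_F₁))
    have h1 : Tendsto (fun y => y * A.F₁ y - 2 * A.b₂ * (1 - A.F₁ y)) (𝓝[Ioo A.a₁ A.a₂] A.a₂)
        (𝓝 A.a₂) := by
      have h2 := (hc A.a₂ ⟨hA.a₁_lt_a₂.le, le_rfl⟩).mono Ioo_subset_Icc_self
      simpa [ContinuousWithinAt, hA.F₁_a₂] using h2
    rw [nhdsWithin_Ioo_eq_nhdsLT hA.a₁_lt_a₂] at h1
    obtain ⟨y, h2, h3⟩ := ((h1.eventually (lt_mem_nhds ha)).and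
      (Ioo_mem_nhdsLT hA.a₁_lt_a₂)).exists
    exact ⟨y, h3, h2⟩
  have hg := hA.isEqualBid_zero.modify (u := y) (v := A.a₂) (c := A.b₂) ⟨hb0, le_rfl⟩
    (fun t _ _ => hb0) (fun t ht h => absurd ht.2 (not_le.2 h))
  set g : ℝ → ℝ := fun t => if t ∈ Ioc y A.a₂ then A.b₂ else 0 with hgdef
  obtain ⟨s, hs⟩ := hg.exists_strategy hA
  obtain ⟨K, hK0, hK⟩ := hA.exists_payment_bound
  have hm := hA.law_real_Ioc_a₂ (Ioo_subset_Icc_self hy)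
  have hFy := hA.F₁_pos (Ioo_subset_Ioc_self hy)
  have hgind : g = (Ioc y A.a₂).indicator fun _ => A.b₂ := by
    ext t; simp [hgdef, indicator_apply]
  have hpay : ∀ t ∈ Ioc A.a₁ A.a₂, A.pw (s t) * A.F₁ t + A.pp (s t)
      = A.law.real (Ioc A.a₁ t ∩ Ioc y A.a₂) * A.b₂ := by
    intro t ht
    rw [hs.payment_eq hA ht, hgind, setIntegral_indicator measurableSet_Ioc, setIntegral_const,
      smul_eq_mul]
  have hpos : ∀ t ∈ Ioc y A.a₂, 0 < (t - A.pw (s t)) * A.F₂ (g t) - A.pp (s t) := by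
    intro t ht
    have ht' : t ∈ Ioc A.a₁ A.a₂ := ⟨hy.1.trans ht.1, ht.2⟩
    obtain ⟨h1, h2, -, -⟩ := hK g s hg hs t ht'
    have h3 : A.law.real (Ioc A.a₁ t ∩ Ioc y A.a₂) ≤ 1 - A.F₁ y :=
      hm ▸ measureReal_mono inter_subset_right
    have h4 := hpay t ht'
    have h5 := mul_le_mul_of_nonneg_right h3 hb0
    have h6 := mul_le_mul_of_nonneg_left (hA.F₁_mono ht.1.le) h1
    have h7 := mul_le_mul_of_nonneg_left (hA.F₁_le_one y) h2
    have h8 := mul_le_mul_of_nonneg_right ht.1.le hFy.le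
    have h9 : g t = A.b₂ := if_pos ht
    have h10 := mul_nonneg h1 hFy.le
    rw [h9, hA.F₂_b₂, mul_one]
    refine pos_of_mul_pos_left (b := A.F₁ y) ?_ hFy.le
    nlinarith
  refine ⟨g, s, hg, hs, ?_⟩
  rw [hA.leaderUtility_eq]
  refine hA.integral_law_pos (hs.integrable_utility hg hA) (ae_law_of_forall fun t ht => ?_)
    (y := y) ⟨hy.1.le, hy.2⟩ fun t ht => hpos t (Ioo_subset_Ioc_self ht)
  rcases lt_or_ge y t with h | h
  · exact (hpos t ⟨h, ht.2⟩).le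
  · obtain ⟨h1, h2, -, -⟩ := hK g s hg hs t ht
    have h3 : g t = 0 := if_neg fun h' => absurd h'.1 (not_lt.2 h)
    have h4 := hpay t ht
    have h5 : Ioc A.a₁ t ∩ Ioc y A.a₂ = ∅ := by
      ext u; simp only [mem_inter_iff, mem_Ioc, mem_empty_iff_false, iff_false]; grind
    rw [h5, measureReal_empty, zero_mul] at h4
    have h6 := mul_nonneg h1 (hA.F₁_pos ht).le
    rw [h3, hA.F₂_eq_zero hA.b₁_nonneg]
    linarith

/-- A positive utility forces F₂(g(u)) > 0 at some u < a₂, hence by monotonicity at all later types,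
where the rate is then positive. -/
theorem IsOptimal.tailLoss_pos (hopt : A.IsOptimal g s) (hA : A.Standing) {x : ℝ}
    (hx : x ∈ Ioo A.a₁ A.a₂) : 0 < A.tailLoss g s x := by
  have hg := hopt.1
  have hs := hopt.2.1
  obtain ⟨K, hK0, hK⟩ := hA.exists_payment_bound
  obtain ⟨g', s', hg', hs', hpos⟩ := hA.exists_utility_pos
  have hU := hpos.trans_le (hopt.2.2 g' s' hg' hs')
  obtain ⟨u, hu, hFu⟩ : ∃ u ∈ Ioo A.a₁ A.a₂, 0 < A.F₂ (g u) := by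
    by_contra! hne
    refine absurd hU (not_lt.2 ?_)
    rw [hA.leaderUtility_eq]
    refine integral_nonpos_of_ae (ae_law_of_forall_Ioo fun t ht => ?_)
    have h1 := le_antisymm (hne t ht) (hA.F₂_nonneg _)
    have h2 := (hK g s hg hs t (Ioo_subset_Ioc_self ht)).2.1
    simp only [Pi.zero_apply]
    rw [h1]
    linarith
  rw [tailLoss, ← integral_indicator measurableSet_Ioc]
  refine hA.integral_law_pos ((integrable_indicator_iff measurableSet_Ioc).2
    (hs.integrableOn_rate hg hA hx.1)) (ae_law_of_forall fun t ht => ?_) (y := max x u)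
    ⟨hx.1.le.trans (le_max_left _ _), max_lt hx.2 hu.2⟩ fun t ht => ?_
  · exact indicator_nonneg (fun t ht => hs.rate_nonneg hA ⟨hx.1.trans ht.1, ht.2⟩) t
  · have h1 := (le_max_left x u).trans_lt ht.1
    have h2 := (le_max_right x u).trans_lt ht.1
    have h3 : t ∈ Ioc A.a₁ A.a₂ := ⟨hx.1.trans h1, ht.2.le⟩
    rw [indicator_of_mem (show t ∈ Ioc x A.a₂ from ⟨h1, ht.2.le⟩)]
    exact hs.rate_pos hA h3 (hFu.trans_le
      (hA.F₂_mono (hg.monotoneOn (Ioo_subset_Ioc_self hu) h3 h2.le)))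

end RankBidAuction

/-- Chain rule along u ↦ y + uη on (0, 1]; a derivative within the side into which η points is
enough, as needed at the kinks of F₂. -/
theorem HasDerivWithinAt.tendsto_quotient_one_div {F : ℝ → ℝ} {D y η : ℝ} {S : Set ℝ}
    (h : HasDerivWithinAt F D S y) (hS : ∀ u, 0 < u → u ≤ 1 → y + u * η ∈ S) :
    Tendsto (fun n : ℕ => (F (y + 1 / ((n : ℝ) + 1) * η) - F y) / (1 / ((n : ℝ) + 1))) atTop
      (𝓝 (D * η)) := by
  have h0 : HasDerivWithinAt (fun u : ℝ => y + u * η) η (Ioc 0 1) 0 := by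
    simpa using (((hasDerivAt_id (0 : ℝ)).mul_const η).const_add y).hasDerivWithinAt
  have h1 : HasDerivWithinAt (fun u : ℝ => F (y + u * η)) (D * η) (Ioc 0 1) 0 := by
    refine HasDerivWithinAt.comp (h₂ := F) (h := fun u : ℝ => y + u * η) 0 ?_ h0
      fun u hu => hS u hu.1 hu.2
    simpa using h
  rw [hasDerivWithinAt_iff_tendsto_slope' (by simp)] at h1
  have h2 : Tendsto (fun n : ℕ => 1 / ((n : ℝ) + 1)) atTop (𝓝[Ioc 0 1] 0) := by
    refine tendsto_nhdsWithin_iff.2 ⟨tendsto_one_div_add_atTop_nhds_zero_nat,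
      Eventually.of_forall fun n => ⟨Nat.one_div_pos_of_nat, ?_⟩⟩
    rw [div_le_one (by positivity)]
    linarith [n.cast_nonneg (α := ℝ)]
  refine (h1.comp h2).congr fun n => ?_
  simp [slope_def_field]

/-! ### Pooling where the Lagrange derivative has a sign. -/

namespace RankBidAuction

variable {A : RankBidAuction} {g s : ℝ → ℝ}

/-- Types with a positive marginal utility of a higher equal bid raise it as far as possible. -/
theorem IsOptimal.eq_of_marginal_pos (hopt : A.IsOptimal g s) (hA : A.Standing) {L : Set ℝ}
    (hL : L ⊆ Ioc A.a₁ A.a₂) (hconn : L.OrdConnected) {q c : ℝ} (hq : IsLUB L q)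
    (hc0 : c ∈ Icc 0 A.b₂) (hcL : ∀ x ∈ L, g x ≤ c)
    (hc : ∀ t ∈ Ioc A.a₁ A.a₂, q < t → c ≤ g t)
    (hk : ∀ x ∈ L, 0 < (x - A.pw (s x)) * A.f₂ (g x) - A.tailLoss g s x) :
    ∀ x ∈ L, g x = c := by
  have hg := hopt.1
  intro x hx
  -- Points of L with another point of L below them: g is raised to c on (x, q]. If g(y) < c, then g
  -- < c on (x, y) by monotonicity, so the integrand is positive there.
  have key : ∀ y ∈ L, x < y → c ≤ g y := by
    intro y hy hxy
    by_contra! hlt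
    have hmemL : ∀ t, x < t → t < q → t ∈ L := by
      intro t h1 h2
      obtain ⟨z, hz, htz, -⟩ := hq.exists_between h2
      exact hconn.out hx hz ⟨h1.le, htz.le⟩
    have hg' := hg.modify (u := x) (v := q) hc0
      (fun t ht htx => (hg.monotoneOn ht (hL hx) htx).trans (hcL x hx)) hc
    set g' : ℝ → ℝ := fun t => if t ∈ Ioc x q then c else g t with hg'def
    have hin : ∀ t, x < t → t < q → g' t = c := fun t h1 h2 => if_pos ⟨h1, h2.le⟩
    have hge : ∀ t, t ≠ q → g t ≤ g' t := by
      intro t htq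
      simp only [hg'def]
      split_ifs with h
      · exact hcL t (hmemL t h.1 (lt_of_le_of_ne h.2 htq))
      · exact le_rfl
    have hge' : ∀ t ∈ Ioc A.a₁ A.a₂, g t ≤ g' t := by
      intro t ht
      by_cases htq : t = q
      -- The supremum need not belong to L; g ≤ c extends to it by left continuity.
      · subst htq
        have hyt : y ≤ t := hq.1 hy
        rw [show g' t = c from if_pos ⟨hxy.trans_le hyt, le_rfl⟩]
        refine le_of_tendsto (hg.leftContinuous t ht |>.mono Iio_subset_Iic_self) ?_
        filter_upwards [Ioo_mem_nhdsLT (hxy.trans_le hyt)] with z hz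
        exact hcL z (hmemL z hz.1 hz.2)
      · exact hge t htq
    have hd : ∀ t ∈ Ioo A.a₁ A.a₂, Tendsto (fun n : ℕ =>
        (A.F₂ (g t + 1 / ((n : ℝ) + 1) * (g' t - g t)) - A.F₂ (g t)) / (1 / ((n : ℝ) + 1)))
        atTop (𝓝 (A.f₂ (g t) * (g' t - g t))) := by
      intro t ht
      have ht' := Ioo_subset_Ioc_self ht
      have h1 := hge' t ht'
      rcases h1.eq_or_lt with h | h
      · rw [← h]; simp
      · refine (hA.hasDerivWithinAt_F₂_Ici (h.trans_le
          (hg'.mem_Icc t ht').2)).tendsto_quotient_one_div fun u hu _ => ?_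
        have := mul_nonneg hu.le (sub_nonneg.2 h1)
        simp only [mem_Ici]; linarith
    have hprod : ∀ t ∈ L, 0 ≤ g' t - g t →
        0 ≤ (t - A.pw (s t)) * (A.f₂ (g t) * (g' t - g t)) - (g' t - g t) * A.tailLoss g s t := by
      intro t ht h
      have := mul_nonneg h (hk t ht).le
      linarith
    have hne : ∀ᵐ t ∂A.law, t ≠ q := by simp [ae_iff]
    have hmem : ∀ᵐ t ∂A.law, t ∈ Ioc A.a₁ A.a₂ := ae_law_of_forall fun t ht => ht
    obtain ⟨t, ht, h0⟩ := hopt.not_forall_pos hA hg' hd (by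
      filter_upwards [hne, hmem] with t htq ht
      by_cases h : t ∈ Ioc x q
      · exact hprod t (hmemL t h.1 (lt_of_le_of_ne h.2 htq)) (sub_nonneg.2 (hge' t ht))
      · have : g' t = g t := if_neg h
        simp [this]) (hL hx).1.le hxy (hL hy).2
    have hyq : y ≤ q := hq.1 hy
    have htL := hmemL t ht.1 (ht.2.trans_le hyq)
    have h1 : g t < c := (hg.monotoneOn (hL htL) (hL hy) ht.2.le).trans_lt hlt
    rw [hin t ht.1 (ht.2.trans_le hyq)] at h0
    have := mul_pos (sub_pos.2 h1) (hk t htL)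
    linarith
  -- If x is the least point of L, `key` says nothing about g(x) itself; all types above x have g ≥
  -- c, so the needle variation applies.
  refine le_antisymm (hcL x hx) (hopt.not_raisable hA (hL hx) (hk x hx) hc0.2 fun t ht hxt => ?_)
  by_cases htL : t ∈ L
  · exact key t htL hxt
  have hub : t ∈ upperBounds L := fun y hy => by
    by_contra! h
    exact htL (hconn.out hx hy ⟨hxt.le, h.le⟩)
  rcases (hq.2 hub).eq_or_lt with h | h
  · obtain ⟨y, hy, hxy, hyq⟩ := hq.exists_between (h ▸ hxt : x < q)
    exact (key y hy hxy).trans (hg.monotoneOn (hL hy) ht (h ▸ hyq))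
  · exact hc t ht h

/-- Types with a negative marginal utility of a higher equal bid lower it as far as possible. -/
theorem IsOptimal.eq_of_marginal_neg (hopt : A.IsOptimal g s) (hA : A.Standing) {L : Set ℝ}
    (hL : L ⊆ Ioc A.a₁ A.a₂) (hconn : L.OrdConnected) {p c : ℝ} (hp : IsGLB L p)
    (hc0 : c ∈ Icc 0 A.b₂) (hcL : ∀ x ∈ L, c ≤ g x)
    (hc : ∀ t ∈ Ioc A.a₁ A.a₂, t ≤ p → g t ≤ c)
    (hk : ∀ x ∈ L, (x - A.pw (s x)) * A.f₂ (g x) - A.tailLoss g s x < 0) :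
    ∀ x ∈ L, g x = c := by
  have hg := hopt.1
  intro x hx
  by_contra hne
  have hlt : c < g x := lt_of_le_of_ne (hcL x hx) (Ne.symm hne)
  have hpx : p < x := by
    by_contra! h
    exact absurd (hc x (hL hx) h) (not_le.2 hlt)
  have hap : A.a₁ ≤ p := hp.2 fun y hy => (hL hy).1.le
  have hmemL : ∀ t, p < t → t ≤ x → t ∈ L := by
    intro t h1 h2
    obtain ⟨z, hz, -, htz⟩ := hp.exists_between h1
    exact hconn.out hz hx ⟨htz.le, h2⟩
  have hg' := hg.modify (u := p) (v := x) hc0 hc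
    (fun t ht htx => (hcL x hx).trans (hg.monotoneOn (hL hx) ht htx.le))
  set g' : ℝ → ℝ := fun t => if t ∈ Ioc p x then c else g t with hg'def
  have hge : ∀ t, g' t ≤ g t := by
    intro t
    simp only [hg'def]
    split_ifs with h
    · exact hcL t (hmemL t h.1 h.2)
    · exact le_rfl
  have hd : ∀ t ∈ Ioo A.a₁ A.a₂, Tendsto (fun n : ℕ =>
      (A.F₂ (g t + 1 / ((n : ℝ) + 1) * (g' t - g t)) - A.F₂ (g t)) / (1 / ((n : ℝ) + 1)))
      atTop (𝓝 ((if g t ≤ A.b₁ then 0 else A.f₂ (g t)) * (g' t - g t))) := by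
    intro t ht
    refine (hA.hasDerivWithinAt_F₂_Iic
      (hg.mem_Icc t (Ioo_subset_Ioc_self ht)).2).tendsto_quotient_one_div fun u hu _ => ?_
    have := mul_nonneg hu.le (sub_nonneg.2 (hge t))
    simp only [mem_Iic]; linarith
  -- For g(t) ≤ b₁ the left derivative of F₂ is 0, possibly unlike f₂(g(t)), and the sign comes from
  -- the positive tail loss instead of from `hk`.
  have hneg : ∀ t ∈ L, t < A.a₂ →
      (t - A.pw (s t)) * (if g t ≤ A.b₁ then 0 else A.f₂ (g t)) - A.tailLoss g s t < 0 := by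
    intro t ht hta
    split_ifs with h
    · have := hopt.tailLoss_pos hA ⟨(hL ht).1, hta⟩
      linarith
    · exact hk t ht
  -- By left continuity g exceeds c on an interval ending at x, where the integrand is then
  -- positive.
  obtain ⟨u, hux, hu⟩ : ∃ u < x, Ioc u x ⊆ {t | c < g t} :=
    (mem_nhdsLE_iff_exists_Ioc_subset).1
      ((hg.leftContinuous x (hL hx)).eventually (lt_mem_nhds hlt))
  obtain ⟨t, ht, h0⟩ := hopt.not_forall_pos hA hg' hd (ae_law_of_forall_Ioo fun t ht => by
      by_cases h : t ∈ Ioc p x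
      · have h1 := hneg t (hmemL t h.1 h.2) ht.2
        have := mul_nonneg (sub_nonneg.2 (hge t)) (neg_pos.2 h1).le
        linarith
      · have : g' t = g t := if_neg h
        simp [this]) (hap.trans (le_max_left p u)) (max_lt hpx hux) (hL hx).2
  have h1 := (le_max_left p u).trans_lt ht.1
  have h2 := (le_max_right p u).trans_lt ht.1
  have h3 : c < g t := hu ⟨h2, ht.2.le⟩
  have h4 := hneg t (hmemL t h1 ht.2.le) (ht.2.trans_le (hL hx).2)
  rw [show g' t = c from if_pos ⟨h1, ht.2.le⟩] at h0
  have := mul_pos (sub_pos.2 h3) (neg_pos.2 h4)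
  linarith

/-- An equal-bid function extends to a monotone function on the line. -/
theorem IsEqualBid.exists_monotone_extension (hg : A.IsEqualBid g) (hA : A.Standing) :
    ∃ G : ℝ → ℝ, Monotone G ∧ (∀ t, G t ∈ Icc 0 A.b₂) ∧ ∀ t ∈ Ioc A.a₁ A.a₂, G t = g t := by
  refine ⟨fun t => if t ≤ A.a₁ then 0 else if t ≤ A.a₂ then g t else A.b₂, fun x y hxy => ?_,
    fun t => ?_, fun t ht => ?_⟩
  · have hb := hA.b₂_nonneg
    dsimp only
    split_ifs with h1 h2 h3 h4 h5 h6 h7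
    · exact le_rfl
    · exact (hg.mem_Icc y ⟨not_le.1 h2, h3⟩).1
    · exact hb
    · exact absurd (hxy.trans h5) h1
    · exact hg.monotoneOn ⟨not_le.1 h1, h4⟩ ⟨not_le.1 h5, h6⟩ hxy
    · exact (hg.mem_Icc x ⟨not_le.1 h1, h4⟩).2
    · exact absurd (hxy.trans h7) h1
    · exact absurd (hxy.trans (by assumption)) h4
    · exact le_rfl
  · have hb := hA.b₂_nonneg
    dsimp only
    split_ifs with h1 h2
    · exact ⟨le_rfl, hb⟩
    · exact hg.mem_Icc t ⟨not_le.1 h1, h2⟩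
    · exact ⟨hb, le_rfl⟩
  · dsimp only
    rw [if_neg (not_le.2 ht.1), if_pos ht.2]

/-- Where the marginal utility of a higher equal bid is positive, an optimal equal-bid function
equals its limit from above at the supremum, or `b₂`. -/
theorem IsOptimal.eq_of_lagrangeDeriv_pos (hopt : A.IsOptimal g s) (hA : A.Standing)
    {L : Set ℝ} (hL : L ⊆ Ioc A.a₁ A.a₂) (hconn : L.OrdConnected) (hne : L.Nonempty)
    (hh : ∀ x ∈ L, 0 < A.lagrangeDeriv g s x) :
    (sSup L < A.a₂ → ∃ c, Tendsto g (𝓝[>] (sSup L)) (𝓝 c) ∧ ∀ x ∈ L, g x = c) ∧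
      (sSup L = A.a₂ → ∀ x ∈ L, g x = A.b₂) := by
  have hg := hopt.1
  have hk : ∀ x ∈ L, 0 < (x - A.pw (s x)) * A.f₂ (g x) - A.tailLoss g s x := fun x hx => by
    have h := hh x hx
    rw [hA.lagrangeDeriv_eq (hL hx)] at h
    exact pos_of_mul_pos_right h (hA.f₁_nonneg x)
  have hq : IsLUB L (sSup L) := isLUB_csSup hne ⟨A.a₂, fun x hx => (hL hx).2⟩
  refine ⟨fun hlt => ?_, fun heq => ?_⟩
  · obtain ⟨G, hGm, hGb, hGg⟩ := hg.exists_monotone_extension hA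
    have hbdd : BddBelow (G '' Ioi (sSup L)) := ⟨0, by rintro _ ⟨t, -, rfl⟩; exact (hGb t).1⟩
    have hGne : (G '' Ioi (sSup L)).Nonempty := nonempty_Ioi.image G
    have haq : A.a₁ < sSup L := by
      obtain ⟨x, hx⟩ := hne
      exact (hL hx).1.trans_le (hq.1 hx)
    refine ⟨sInf (G '' Ioi (sSup L)), ?_, ?_⟩
    · refine (hGm.tendsto_nhdsGT (sSup L)).congr' ?_
      filter_upwards [Ioo_mem_nhdsGT hlt] with t ht
      exact hGg t ⟨haq.trans ht.1, ht.2.le⟩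
    · refine hopt.eq_of_marginal_pos hA hL hconn hq ⟨?_, ?_⟩ (fun x hx => ?_)
        (fun t ht hqt => ?_) hk
      · exact le_csInf hGne (by rintro _ ⟨t, -, rfl⟩; exact (hGb t).1)
      · exact (csInf_le hbdd (mem_image_of_mem G (mem_Ioi.2 hlt))).trans (hGb _).2
      · refine le_csInf hGne ?_
        rintro _ ⟨t, ht, rfl⟩
        rw [← hGg x (hL hx)]
        exact hGm ((hq.1 hx).trans (mem_Ioi.1 ht).le)
      · rw [← hGg t ht]
        exact csInf_le hbdd (mem_image_of_mem G (mem_Ioi.2 hqt))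
  · exact hopt.eq_of_marginal_pos hA hL hconn hq ⟨hA.b₂_nonneg, le_rfl⟩
      (fun x hx => (hg.mem_Icc x (hL hx)).2)
      (fun t ht hqt => absurd ht.2 (not_le.2 (heq ▸ hqt))) hk

/-- Where the marginal utility of a higher equal bid is negative, an optimal equal-bid function
equals its limit from below at the infimum, or `0`. -/
theorem IsOptimal.eq_of_lagrangeDeriv_neg (hopt : A.IsOptimal g s) (hA : A.Standing)
    {L : Set ℝ} (hL : L ⊆ Ioc A.a₁ A.a₂) (hconn : L.OrdConnected) (hne : L.Nonempty)
    (hh : ∀ x ∈ L, A.lagrangeDeriv g s x < 0) :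
    (A.a₁ < sInf L → ∃ c, Tendsto g (𝓝[<] (sInf L)) (𝓝 c) ∧ ∀ x ∈ L, g x = c) ∧
      (sInf L = A.a₁ → ∀ x ∈ L, g x = 0) := by
  have hg := hopt.1
  have hk : ∀ x ∈ L, (x - A.pw (s x)) * A.f₂ (g x) - A.tailLoss g s x < 0 := fun x hx => by
    have h := hh x hx
    rw [hA.lagrangeDeriv_eq (hL hx)] at h
    by_contra! h'
    exact absurd (mul_nonneg (hA.f₁_nonneg x) h') (not_le.2 h)
  have hp : IsGLB L (sInf L) := isGLB_csInf hne ⟨A.a₁, fun x hx => (hL hx).1.le⟩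
  refine ⟨fun hlt => ?_, fun heq => ?_⟩
  · have hmem : sInf L ∈ Ioc A.a₁ A.a₂ := by
      obtain ⟨x, hx⟩ := hne
      exact ⟨hlt, (hp.1 hx).trans (hL hx).2⟩
    refine ⟨g (sInf L), (hg.leftContinuous _ hmem).mono Iio_subset_Iic_self, ?_⟩
    exact hopt.eq_of_marginal_neg hA hL hconn hp (hg.mem_Icc _ hmem)
      (fun x hx => hg.monotoneOn hmem (hL hx) (hp.1 hx))
      (fun t ht htp => hg.monotoneOn ht hmem htp) hk
  · exact hopt.eq_of_marginal_neg hA hL hconn hp ⟨le_rfl, hA.b₂_nonneg⟩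
      (fun x hx => (hg.mem_Icc x (hL hx)).1)
      (fun t ht htp => absurd ht.1 (not_lt.2 (heq ▸ htp))) hk

end RankBidAuction

/-! ### Existence of an optimum and truncation. -/

/-- Helly's selection theorem for uniformly bounded monotone functions. -/
theorem exists_subseq_tendsto_of_monotone {a b : ℝ} {G : ℕ → ℝ → ℝ} (hm : ∀ n, Monotone (G n))
    (hb : ∀ n t, G n t ∈ Icc a b) :
    ∃ φ : ℕ → ℕ, StrictMono φ ∧ ∃ H : ℝ → ℝ, Monotone H ∧ (∀ t, H t ∈ Icc a b) ∧
      (∀ t, ContinuousWithinAt H (Iic t) t) ∧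
      ∀ t, ContinuousAt H t → Tendsto (fun n => G (φ n) t) atTop (𝓝 (H t)) := by
  -- The product of copies of [a, b] over the rationals is compact and metrizable, hence
  -- sequentially compact.
  obtain ⟨l, φ, hφ, hl⟩ := CompactSpace.tendsto_subseq
    (fun n => (fun q : ℚ => (⟨G n q, hb n q⟩ : Icc a b)))
  have hlim : ∀ q : ℚ, Tendsto (fun n => G (φ n) q) atTop (𝓝 (l q : ℝ)) := fun q =>
    (continuous_subtype_val.tendsto _).comp (tendsto_pi_nhds.1 hl q)
  have hlb : ∀ q, (l q : ℝ) ∈ Icc a b := fun q => (l q).2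
  -- The strict inequality q < x makes the supremum left continuous in x.
  set S : ℝ → Set ℝ := fun x => (fun q : ℚ => (l q : ℝ)) '' {q : ℚ | (q : ℝ) < x} with hS
  have hne : ∀ x, (S x).Nonempty := fun x => by
    obtain ⟨q, hq⟩ := exists_rat_lt x
    exact ⟨_, q, hq, rfl⟩
  have hbdd : ∀ x, BddAbove (S x) := fun x => ⟨b, by rintro _ ⟨q, -, rfl⟩; exact (hlb q).2⟩
  set H : ℝ → ℝ := fun x => sSup (S x) with hH
  have hle : ∀ {q : ℚ} {x : ℝ}, (q : ℝ) < x → (l q : ℝ) ≤ H x := fun hq =>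
    le_csSup (hbdd _) ⟨_, hq, rfl⟩
  have hlt : ∀ {x c : ℝ}, c < H x → ∃ q : ℚ, (q : ℝ) < x ∧ c < l q := by
    intro x c hc
    obtain ⟨_, ⟨q, hq, rfl⟩, h⟩ := exists_lt_of_lt_csSup (hne x) hc
    exact ⟨q, hq, h⟩
  have hmono : Monotone H := fun x y hxy =>
    csSup_le_csSup (hbdd y) (hne x) (image_mono fun q hq => lt_of_lt_of_le hq hxy)
  refine ⟨φ, hφ, H, hmono, fun t => ⟨?_, ?_⟩, fun t => ?_, fun t ht => ?_⟩
  · obtain ⟨q, hq⟩ := exists_rat_lt t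
    exact (hlb q).1.trans (hle hq)
  · exact csSup_le (hne t) (by rintro _ ⟨q, -, rfl⟩; exact (hlb q).2)
  · refine tendsto_order.2 ⟨fun c hc => ?_, fun c hc => ?_⟩
    · obtain ⟨q, hq, h⟩ := hlt hc
      filter_upwards [Ioc_mem_nhdsLE hq] with u hu
      exact h.trans_le (hle hu.1)
    · filter_upwards [self_mem_nhdsWithin] with u hu
      exact (hmono hu).trans_lt hc
  · refine tendsto_order.2 ⟨fun c hc => ?_, fun c hc => ?_⟩
    · obtain ⟨q, hq, h⟩ := hlt hc
      filter_upwards [(hlim q).eventually (lt_mem_nhds h)] with n hn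
      exact hn.trans_le (hm _ hq.le)
    · obtain ⟨y, hy, hty⟩ := ((((tendsto_order.1 ht).2 c hc).filter_mono
        (nhdsWithin_le_nhds (s := Ioi t))).and self_mem_nhdsWithin).exists
      obtain ⟨q, htq, hqy⟩ := exists_rat_btwn hty
      filter_upwards [(hlim q).eventually (gt_mem_nhds ((hle hqy).trans_lt hy))] with n hn
      exact (hm _ htq.le).trans_lt hn

namespace RankBidAuction

variable {A : RankBidAuction} {g s : ℝ → ℝ}

/-- The utility is continuous with respect to almost everywhere convergence. -/
theorem Standing.tendsto_leaderUtility (hA : A.Standing)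
    (hs : A.IsStrategyOf g s) {gn sn : ℕ → ℝ → ℝ} (hgn : ∀ n, A.IsEqualBid (gn n))
    (hsn : ∀ n, A.IsStrategyOf (gn n) (sn n))
    (h : ∀ᵐ t ∂A.law, Tendsto (fun n => gn n t) atTop (𝓝 (g t))) :
    Tendsto (fun n => A.leaderUtility (gn n) (sn n)) atTop (𝓝 (A.leaderUtility g s)) := by
  have hfin := hA.isFiniteMeasure_law
  obtain ⟨K, hK0, hK⟩ := hA.exists_payment_bound
  simp only [hA.leaderUtility_eq]
  have hmem : ∀ᵐ t ∂A.law, t ∈ Ioc A.a₁ A.a₂ := ae_law_of_forall fun t ht => ht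
  -- Expected payments converge by dominated convergence, and the bid depends continuously on its
  -- cost.
  have hst : ∀ t ∈ Ioc A.a₁ A.a₂, Tendsto (fun n => sn n t) atTop (𝓝 (s t)) := by
    intro t ht
    refine hA.tendsto_bid (w := fun _ => A.F₁ t) (hA.F₁_pos ht) (hs t ht).1
      (Eventually.of_forall fun n => (hsn n t ht).1) tendsto_const_nhds ?_
    simp only [hs.payment_eq hA ht, (hsn _).payment_eq hA ht]
    refine tendsto_integral_filter_of_norm_le_const
      (Eventually.of_forall fun n => (hgn n).aestronglyMeasurable.restrict)
      ⟨A.b₂, Eventually.of_forall fun n => ae_restrict_of_ae (ae_law_of_forall fun u hu => ?_)⟩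
      (ae_restrict_of_ae h)
    rw [Real.norm_eq_abs, abs_of_nonneg ((hgn n).mem_Icc u hu).1]
    exact ((hgn n).mem_Icc u hu).2
  refine tendsto_integral_filter_of_norm_le_const
    (Eventually.of_forall fun n => ((hsn n).integrable_utility (hgn n) hA).aestronglyMeasurable)
    ⟨K * 1 + K, Eventually.of_forall fun n => ae_law_of_forall fun t ht => ?_⟩ ?_
  · obtain ⟨-, -, h3, h4⟩ := hK _ _ (hgn n) (hsn n) t ht
    rw [Real.norm_eq_abs]
    refine (abs_sub _ _).trans (add_le_add ?_ h3)
    rw [abs_mul]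
    exact mul_le_mul h4 (hA.abs_F₂_le _) (abs_nonneg _) hK0
  · filter_upwards [h, hmem] with t ht htm
    have h1 := hst t htm
    exact ((tendsto_const_nhds.sub ((hA.differentiable_pw.continuous.tendsto _).comp h1)).mul
      ((hA.continuous_F₂.tendsto _).comp ht)).sub
      ((hA.differentiable_pp.continuous.tendsto _).comp h1)

/-- Direct method. A Helly limit of a maximizing sequence is left continuous, hence admissible;
convergence can fail only at its countably many discontinuities, which the atomless law ignores. -/
theorem Standing.exists_isOptimal (hA : A.Standing) : ∃ g s, A.IsOptimal g s := by
  have hfin := hA.isFiniteMeasure_law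
  obtain ⟨K, hK0, hK⟩ := hA.exists_payment_bound
  set V : Set ℝ := {v | ∃ g s, A.IsEqualBid g ∧ A.IsStrategyOf g s ∧ A.leaderUtility g s = v}
    with hV
  have hVne : V.Nonempty := by
    obtain ⟨g, s, hg, hs, -⟩ := hA.exists_utility_pos
    exact ⟨_, g, s, hg, hs, rfl⟩
  have hVb : BddAbove V := by
    refine ⟨K, ?_⟩
    rintro _ ⟨g, s, hg, hs, rfl⟩
    have h1 : ∫ x, ((x - A.pw (s x)) * A.F₂ (g x) - A.pp (s x)) ∂A.law ≤ ∫ _, K ∂A.law := by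
      refine integral_mono_ae (hs.integrable_utility hg hA) (integrable_const _)
        (ae_law_of_forall fun t ht => ?_)
      obtain ⟨-, h2, -, h4⟩ := hK g s hg hs t ht
      have h5 : (t - A.pw (s t)) * A.F₂ (g t) ≤ K * 1 := by
        refine (le_abs_self _).trans ?_
        rw [abs_mul]
        exact mul_le_mul h4 (hA.abs_F₂_le _) (abs_nonneg _) hK0
      linarith
    rwa [← hA.leaderUtility_eq, integral_const, hA.law_univ, one_smul] at h1
  obtain ⟨v, -, hvt, hv⟩ := exists_seq_tendsto_sSup hVne hVb
  choose gn sn hgn hsn hU using hv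
  choose G hGm hGb hGg using fun n => (hgn n).exists_monotone_extension hA
  obtain ⟨φ, hφ, H, hHm, hHb, hHl, hHt⟩ := exists_subseq_tendsto_of_monotone hGm hGb
  have hH : A.IsEqualBid H := ⟨fun t _ => hHb t, hHm.monotoneOn _, fun t _ => hHl t⟩
  obtain ⟨s, hs⟩ := hH.exists_strategy hA
  have hae : ∀ᵐ t ∂A.law, Tendsto (fun n => gn (φ n) t) atTop (𝓝 (H t)) := by
    have hmem : ∀ᵐ t ∂A.law, t ∈ Ioc A.a₁ A.a₂ := ae_law_of_forall fun t ht => ht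
    filter_upwards [hmem, hHm.countable_not_continuousAt.ae_notMem A.law] with t ht htc
    refine (hHt t (not_not.1 htc)).congr fun n => hGg _ t ht
  have hlim := hA.tendsto_leaderUtility hs (fun n => hgn (φ n)) (fun n => hsn (φ n)) hae
  simp only [hU] at hlim
  have heq := tendsto_nhds_unique hlim (hvt.comp hφ.tendsto_atTop)
  refine ⟨H, s, hH, hs, fun g' s' hg' hs' => ?_⟩
  rw [heq]
  exact le_csSup hVb ⟨g', s', hg', hs', rfl⟩

/-- Equal bids that no follower type accepts may be replaced by `0`. -/
theorem IsEqualBid.truncate (hg : A.IsEqualBid g) (hA : A.Standing) :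
    A.IsEqualBid (fun t => if g t ≤ A.b₁ then 0 else g t) where
  mem_Icc x hx := by
    split_ifs
    exacts [⟨le_rfl, hA.b₂_nonneg⟩, hg.mem_Icc x hx]
  monotoneOn x hx y hy hxy := by
    have h := hg.monotoneOn hx hy hxy
    dsimp only
    split_ifs with h1 h2 h2
    · exact le_rfl
    · exact (hg.mem_Icc y hy).1
    · exact absurd (h.trans h2) h1
    · exact h
  leftContinuous x hx := by
    by_cases h : g x ≤ A.b₁
    · refine (continuousWithinAt_const (b := (0 : ℝ))).congr_of_eventuallyEq ?_ (by simp [h])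
      filter_upwards [Ioc_mem_nhdsLE hx.1] with t ht
      exact if_pos ((hg.monotoneOn ⟨ht.1, ht.2.trans hx.2⟩ hx ht.2).trans h)
    · refine (hg.leftContinuous x hx).congr_of_eventuallyEq ?_ (by simp [h])
      filter_upwards [(hg.leftContinuous x hx).eventually (lt_mem_nhds (not_le.1 h))] with t ht
      exact if_neg (not_le.2 ht)

/-- F₂ vanishes up to b₁, so truncation keeps every winning probability. It lowers the integral of
g, hence each bid and both payments, so the utility does not fall. -/
theorem IsOptimal.exists_truncate (hopt : A.IsOptimal g s) (hA : A.Standing) :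
    ∃ g s, A.IsOptimal g s ∧ ∀ x ∈ Ioc A.a₁ A.a₂, g x = 0 ∨ g x ∈ Icc A.b₁ A.b₂ := by
  have hfin := hA.isFiniteMeasure_law
  have hg := hopt.1
  have hs := hopt.2.1
  have hg' := hg.truncate hA
  set g' : ℝ → ℝ := fun t => if g t ≤ A.b₁ then 0 else g t with hg'def
  obtain ⟨s', hs'⟩ := hg'.exists_strategy hA
  have hF : ∀ t, A.F₂ (g' t) = A.F₂ (g t) := by
    intro t
    simp only [hg'def]
    split_ifs with h
    · rw [hA.F₂_eq_zero h, hA.F₂_eq_zero hA.b₁_nonneg]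
    · rfl
  have hle : ∀ t ∈ Ioc A.a₁ A.a₂, g' t ≤ g t := by
    intro t ht
    simp only [hg'def]
    split_ifs with h
    · exact (hg.mem_Icc t ht).1
    · exact le_rfl
  have hsle : ∀ t ∈ Ioc A.a₁ A.a₂, s' t ≤ s t := by
    intro t ht
    refine ((hA.strictMonoOn_payment (hA.F₁_pos ht)).le_iff_le (hs' t ht).1 (hs t ht).1).1 ?_
    rw [hs'.payment_eq hA ht, hs.payment_eq hA ht]
    exact integral_mono_ae (hg'.integrable hA).integrableOn (hg.integrable hA).integrableOn
      (ae_restrict_of_ae (ae_law_of_forall hle))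
  have hU : A.leaderUtility g s ≤ A.leaderUtility g' s' := by
    rw [hA.leaderUtility_eq, hA.leaderUtility_eq]
    refine integral_mono_ae (hs.integrable_utility hg hA) (hs'.integrable_utility hg' hA)
      (ae_law_of_forall fun t ht => ?_)
    have h1 := hA.monotoneOn_pw (mem_Ici.2 (hs' t ht).1) (mem_Ici.2 (hs t ht).1) (hsle t ht)
    have h2 := hA.monotoneOn_pp (mem_Ici.2 (hs' t ht).1) (mem_Ici.2 (hs t ht).1) (hsle t ht)
    have h3 := mul_le_mul_of_nonneg_right h1 (hA.F₂_nonneg (g t))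
    simp only [hF]
    linarith
  refine ⟨g', s', ⟨hg', hs', fun g'' s'' h1 h2 => (hopt.2.2 _ _ h1 h2).trans hU⟩,
    fun x hx => ?_⟩
  by_cases h : g x ≤ A.b₁
  · exact Or.inl (if_pos h)
  · right
    rw [show g' x = g x from if_neg h]
    exact ⟨(not_le.1 h).le, (hg.mem_Icc x hx).2⟩

end RankBidAuction

theorem mainTheorem7 (A : RankBidAuction) (hA : A.Standing) :
    (∀ g s : ℝ → ℝ, A.IsOptimal g s →
      ∀ L : Set ℝ, L ⊆ Ioc A.a₁ A.a₂ → L.OrdConnected → L.Nonempty →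
        ((∀ x ∈ L, 0 < A.lagrangeDeriv g s x) →
          (sSup L < A.a₂ →
            ∃ c, Tendsto g (𝓝[>] (sSup L)) (𝓝 c) ∧ ∀ x ∈ L, g x = c) ∧
          (sSup L = A.a₂ → ∀ x ∈ L, g x = A.b₂)) ∧
        ((∀ x ∈ L, A.lagrangeDeriv g s x < 0) →
          (A.a₁ < sInf L →
            ∃ c, Tendsto g (𝓝[<] (sInf L)) (𝓝 c) ∧ ∀ x ∈ L, g x = c) ∧
          (sInf L = A.a₁ → ∀ x ∈ L, g x = 0))) ∧
    ∃ g s : ℝ → ℝ, A.IsOptimal g s ∧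
      ∀ x ∈ Ioc A.a₁ A.a₂, g x = 0 ∨ g x ∈ Icc A.b₁ A.b₂ := by
  refine ⟨fun g s hopt L hL hconn hne =>
    ⟨hopt.eq_of_lagrangeDeriv_pos hA hL hconn hne, hopt.eq_of_lagrangeDeriv_neg hA hL hconn hne⟩,
    ?_⟩
  obtain ⟨g, s, hopt⟩ := hA.exists_isOptimal
  exact hopt.exists_truncate hA
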